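/- Let $a,b$ be natural numbers with $b<a$, and let $G_c$ be a graph on $n$ vertices (the tasks). Every task consists of a first sub-task of length $a$ and a second sub-task of length $b$ that starts exactly $L=a+b$ time units after the completion of the first. A valid schedule assigns a starting time in $\mathbb N$ to every task such that sub-tasks of different tasks do not overlap in time and a sub-task of one task is executed during the idle time of another only if the two tasks are adjacent in $G_c$; its length $C_{\max}$ is the largest completion time of a task. Min-SLDPC asks for a partition $\mathcal P$ of $G_c$ into vertex-disjoint paths (paths of length $0$ are allowed) that minimizes $n(a+b)+\sum_{p\in\mathcal P}w(p)$, where $w(p)=a$ if $p$ has exactly one edge and $w(p)=a+b$ otherwise. Consider the following algorithm. Compute a maximum matching $M$ of $G_c$; schedule the pairs of $M$ first, one after the other, each pair $\{u,v\}$ interleaved (if $u$ starts at time $s$, then $v$ starts at time $s+a$, and the pair ends at time $s+3a+2b$); then schedule the unmatched tasks sequentially, each taking $2a+2b$ time units. Then: 1. For every maximum matching $M$ and every order of the pairs and of the unmatched tasks, the resulting schedule is valid, its length equals the Min-SLDPC cost of the partition of $G_c$ into the edges of $M$ and the unmatched vertices, and this length is at most $\frac{3a+2b}{2a+2b}$ times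 the cost of any partition of $G_c$ into vertex-disjoint paths, and at most $\frac{3a+2b}{2a+2b}$ times the length of any valid schedule. 2. The algorithm runs in polynomial time: there are one program (for a random access machine with addition and truncated subtraction at unit cost) and a polynomial $q$ such that, on every instance $(G_c,a,b)$, the program outputs the starting times of such a schedule for some maximum matching within $q(n+|a|+|b|)$ steps, where $|a|,|b|$ are bit lengths. 3. The ratio satisfies $\frac54<\frac{3a+2b}{2a+2b}\le\frac32$ whenever $b<a$, and it is less than $\frac32$ if moreover $b>0$. -/

import Mathlib

/-! ### Coupled tasks with a compatibility graph

Every vertex `i` of a graph `G` is a coupled task. Its first sub-task (`false`) has length `a`, its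
second sub-task (`true`) has length `b` and starts exactly `L` time units after the end of the first.
A schedule `σ` gives the starting time `σ i` of every task. -/

/-- Starting time of a sub-task of a coupled task that starts at time `s`. -/
def subStart (a L s : ℕ) : Bool → ℕ
  | false => s
  | true => s + a + L

/-- Completion time of a sub-task of a coupled task that starts at time `s`. -/
def subEnd (a b L s : ℕ) : Bool → ℕ
  | false => s + a
  | true => s + a + L + b

/-- Valid schedules on one processor: sub-tasks of different tasks do not overlap, and a sub-task of
`j` is executed during the idle time of `i` only if `i` and `j` are compatible (adjacent). -/
structure ValidSchedule {V : Type*} (G : SimpleGraph V) (a b L : ℕ) (σ : V → ℕ) : Prop where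
  noOverlap : ∀ i j, i ≠ j → ∀ x y,
    subEnd a b L (σ i) x ≤ subStart a L (σ j) y ∨ subEnd a b L (σ j) y ≤ subStart a L (σ i) x
  compatible : ∀ i j, i ≠ j → ∀ x,
    σ i + a ≤ subStart a L (σ j) x → subEnd a b L (σ j) x ≤ σ i + a + L → G.Adj i j

/-- The length `C_max` of a schedule. -/
def makespan {V : Type*} [Fintype V] (a b L : ℕ) (σ : V → ℕ) : ℕ :=
  Finset.univ.sup fun i => σ i + a + L + b

/-! ### Minimum schedule-linked disjoint-path cover -/

/-- A partition of the graph `G` into vertex-disjoint paths, paths of length `0` being allowed. -/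
structure PathCover {V : Type*} (G : SimpleGraph V) where
  paths : Finset (Σ u : V, Σ v : V, G.Path u v)
  cover : ∀ x : V, ∃! p, p ∈ paths ∧ x ∈ p.2.2.1.support

/-- The objective `n (a + b) + ∑ w p`, where `w p = a` for a path `p` with exactly one edge and
`w p = a + b` for any other path. -/
def PathCover.cost {V : Type*} [Fintype V] {G : SimpleGraph V} (P : PathCover G) (a b : ℕ) : ℕ :=
  Fintype.card V * (a + b) + ∑ p ∈ P.paths, if p.2.2.1.length = 1 then a else a + b

/-! ### Schedules obtained from a maximum matching -/

/-- `M` is a matching of `G` with the largest possible number of edges. -/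
def IsMaximumMatching {V : Type*} {G : SimpleGraph V} (M : G.Subgraph) : Prop :=
  M.IsMatching ∧ ∀ M' : G.Subgraph, M'.IsMatching → M'.edgeSet.ncard ≤ M.edgeSet.ncard

/-- `σ` schedules the edges of the matching `M` first, in some order, without delay between them,
and then the unmatched tasks one after the other. The two tasks `u`, `v` of an edge are interleaved:
`v` starts as soon as the first sub-task of `u` is completed. Such a pair takes `3 a + 2 b` time
units and a single task takes `2 a + 2 b` (the idle time of a task is `a + b`). -/
def IsMatchingSchedule {V : Type*} {G : SimpleGraph V} (M : G.Subgraph) (a b : ℕ)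
    (σ : V → ℕ) : Prop :=
  ∃ (pairs : List (V × V)) (rest : List V),
    (∀ u v, M.Adj u v ↔ (u, v) ∈ pairs ∨ (v, u) ∈ pairs) ∧
    (∀ v, v ∈ rest ↔ v ∉ M.verts) ∧
    ((pairs.flatMap fun p => [p.1, p.2]) ++ rest).Nodup ∧
    (∀ (t : ℕ) (h : t < pairs.length),
      σ pairs[t].1 = t * (3 * a + 2 * b) ∧ σ pairs[t].2 = t * (3 * a + 2 * b) + a) ∧
    (∀ (t : ℕ) (h : t < rest.length),
      σ rest[t] = pairs.length * (3 * a + 2 * b) + t * (2 * a + 2 * b))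

/-! ### A random access machine with step count

Structured programs over natural-number variables and one-dimensional arrays. The available
operations are constants, variables, array access, addition and truncated subtraction, each at unit
cost. There is no multiplication, so that `T` steps add at most `O(T)` bits to the numbers in memory,
and polynomial time on this machine is polynomial time on Turing machines. -/

namespace RAM

/-- Expressions; `get k e` is entry number `e` of the array with name `k`. -/
inductive Expr where
  | lit (c : ℕ)
  | var (x : ℕ)
  | get (k : ℕ) (e : Expr)
  | add (e f : Expr)
  | sub (e f : Expr)

/-- Programs; `ite` and `loop` test whether the value of an expression is nonzero. -/
inductive Prog where
  | skip
  | assign (x : ℕ) (e : Expr)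
  | store (k : ℕ) (i e : Expr)
  | seq (p q : Prog)
  | ite (e : Expr) (p q : Prog)
  | loop (e : Expr) (p : Prog)

/-- Memory contents: the values of the variables and of the entries of the arrays. -/
structure State where
  var : ℕ → ℕ
  arr : ℕ → ℕ → ℕ

/-- The value of an expression. -/
def Expr.eval (s : State) : Expr → ℕ
  | .lit c => c
  | .var x => s.var x
  | .get k e => s.arr k (e.eval s)
  | .add e f => e.eval s + f.eval s
  | .sub e f => e.eval s - f.eval s

/-- The number of steps in the evaluation of an expression. -/
def Expr.cost : Expr → ℕ
  | .lit _ => 1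
  | .var _ => 1
  | .get _ e => e.cost + 1
  | .add e f => e.cost + f.cost + 1
  | .sub e f => e.cost + f.cost + 1

/-- `Runs p s t s'`: started in state `s`, the program `p` halts in state `s'` after `t` steps. -/
inductive Runs : Prog → State → ℕ → State → Prop where
  | skip (s : State) : Runs .skip s 1 s
  | assign (x : ℕ) (e : Expr) (s : State) :
      Runs (.assign x e) s (e.cost + 1) { s with var := Function.update s.var x (e.eval s) }
  | store (k : ℕ) (i e : Expr) (s : State) :
      Runs (.store k i e) s (i.cost + e.cost + 1)
        { s with arr := Function.update s.arr k
                          (Function.update (s.arr k) (i.eval s) (e.eval s)) }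
  | seq {p q : Prog} {s s' s'' : State} {t t' : ℕ} :
      Runs p s t s' → Runs q s' t' s'' → Runs (.seq p q) s (t + t') s''
  | ite_true {e : Expr} {p q : Prog} {s s' : State} {t : ℕ} :
      e.eval s ≠ 0 → Runs p s t s' → Runs (.ite e p q) s (e.cost + 1 + t) s'
  | ite_false {e : Expr} {p q : Prog} {s s' : State} {t : ℕ} :
      e.eval s = 0 → Runs q s t s' → Runs (.ite e p q) s (e.cost + 1 + t) s'
  | loop_true {e : Expr} {p : Prog} {s s' s'' : State} {t t' : ℕ} :
      e.eval s ≠ 0 → Runs p s t s' → Runs (.loop e p) s' t' s'' →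
        Runs (.loop e p) s (e.cost + 1 + t + t') s''
  | loop_false {e : Expr} {p : Prog} {s : State} :
      e.eval s = 0 → Runs (.loop e p) s (e.cost + 1) s

end RAM

open Classical in
/-- Memory at the start on the instance `(G, a, b)`: the variables `0`, `1`, `2` hold `n`, `a`, `b`,
and the array `0` holds the adjacency matrix of `G`, row by row. All the rest is zero. -/
noncomputable def inputState {n : ℕ} (G : SimpleGraph (Fin n)) (a b : ℕ) : RAM.State where
  var := fun x => if x = 0 then n else if x = 1 then a else if x = 2 then b else 0
  arr := fun k m =>
    if k = 0 ∧ ∃ i j : Fin n, m = (i : ℕ) * n + (j : ℕ) ∧ G.Adj i j then 1 else 0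

/-- The schedule that is read off from the memory at the end: the array `1` holds the starting
times. -/
def outputSchedule (n : ℕ) (s : RAM.State) : Fin n → ℕ := fun i => s.arr 1 i

/-- Size of the instance: number of tasks plus the bit lengths of `a` and `b`. -/
def inputSize (n a b : ℕ) : ℕ := n + Nat.size a + Nat.size b

/-! The ratio. Interleaving a pair saves `2 (2 a + 2 b) - (3 a + 2 b) = a + 2 b` time units, so a
matching with `m` edges gives length `n (2 a + 2 b) - m (a + 2 b)` (`MatchingOrder.makespan_add`).
It therefore suffices to extract from any competitor of value `C` some matching whose own schedule
has length at most `(3 a + 2 b) / (2 a + 2 b) * C`; a maximum matching does at least as well. From a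
path cover, take every other edge of each path; the estimate is checked path by path (`path_bound`,
`PathCover.bound`). From a valid schedule, sort the tasks by starting time. A task that starts
before an earlier one has ended starts in its idle time and is adjacent to it
(`ValidSchedule.separated`). Since `b < a`, a first sub-task of length `a` leaves no room for
another one in an idle time of length `a + b`. So a greedy scan pairs consecutive overlapping tasks,
and every pair that is followed by another task occupies at least `2 a + 2 b` time units
(`schedule_bound_list`).

The algorithm. A maximum matching is found by a form of Edmonds' search that neither contracts
blossoms nor traces paths. A matching is an involution, and every outer vertex `v` stores a whole
witness matching, which exposes `v` in place of the root. An edge from `v` to another exposed vertex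
that is not yet reached then augments in one exchange. Growing the tree changes one witness by an
exchange (`Search.Inv.grow`). Closing a blossom glues the witnesses of the two ends of an edge along
the set of vertices below an inner vertex (`Search.Inv.merge`); the invariant says how witnesses
behave on these sets. When no rule applies, outer vertices with the same inner ancestors form odd
classes, one more in number than the inner vertices. A matching that covered all outer vertices
would send an edge from each class to its own inner vertex, which is impossible
(`Search.Inv.not_covered`). Hence no matching covers the root together with everything already
covered. If this holds at every exposed vertex, the matching is maximum (`IsMate.card_le`).

The running time. The program uses only loops that count up to `n`, so its polynomial bound is read
off from its syntax (`Cmd.runs_toProg`), and its correctness follows from loop invariants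
(`Cmd.forn_induction`). One search from every vertex is enough, because covered vertices stay
covered and a failed search remains conclusive (`RAM.matching_run`). -/

/-! ### Matchings as involutions -/

/-- A matching of `G`, given by the map that sends a vertex to its partner; the exposed vertices are
the fixed points. -/
structure IsMate {V : Type*} (G : SimpleGraph V) (f : V → V) : Prop where
  invol : ∀ x, f (f x) = x
  adj : ∀ x, f x ≠ x → G.Adj x (f x)

/-- Match `v` with `w`, after the edge of `w` has been removed. -/
def rematch {V : Type*} [DecidableEq V] (f : V → V) (v w x : V) : V :=
  if x = v then w else if x = w then v else if x = f w then x else f x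

namespace IsMate

variable {V : Type*} {G : SimpleGraph V} {f : V → V}

theorem eq_iff (hf : IsMate G f) {x y : V} : f x = y ↔ x = f y :=
  ⟨fun h => by rw [← h, hf.invol], fun h => by rw [h, hf.invol]⟩

theorem injective (hf : IsMate G f) : Function.Injective f :=
  Function.LeftInverse.injective hf.invol

theorem id (G : SimpleGraph V) : IsMate G fun x => x := ⟨fun _ => rfl, fun _ h => absurd rfl h⟩

variable [DecidableEq V]

theorem rematch (hf : IsMate G f) {v w : V} (hv : f v = v) (hvw : G.Adj v w) :
    IsMate G (rematch f v w) := by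
  have hne := hvw.ne
  have h1 := hf.invol
  have h2 := hf.adj
  constructor
  · intro x
    have := h1 x
    have := h1 w
    unfold _root_.rematch
    grind
  · intro x
    have := h2 x
    have := hvw.symm
    unfold _root_.rematch
    grind

theorem rematch_eq_self (hf : IsMate G f) {v w : V} (hvw : v ≠ w) (x : V) :
    _root_.rematch f v w x = x ↔ x ≠ v ∧ x ≠ w ∧ (x = f w ∨ f x = x) := by
  have h1 := hf.invol
  unfold _root_.rematch
  grind

/-- If no matching covers one more exposed vertex together with all vertices that are covered by
`f`, then `f` has the largest possible number of covered vertices. -/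
theorem card_le [Fintype V] (hf : IsMate G f)
    (hmax : ∀ r, f r = r → ∀ g, IsMate G g → (∀ x, f x ≠ x → g x ≠ x) → g r = r)
    {g : V → V} (hg : IsMate G g) :
    (Finset.univ.filter fun x => g x ≠ x).card ≤ (Finset.univ.filter fun x => f x ≠ x).card := by
  by_contra! hlt
  let P : (V → V) → Prop := fun g => IsMate G g ∧
    (Finset.univ.filter fun x => f x ≠ x).card < (Finset.univ.filter fun x => g x ≠ x).card
  -- Among the larger matchings, choose one that agrees with `f` as much as possible. Extremality
  -- will force it to cover every vertex that `f` covers.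
  obtain ⟨g, ⟨hg, hlt⟩, hbest⟩ : ∃ g, P g ∧ ∀ g', P g' →
      (Finset.univ.filter fun x => g' x = f x ∧ f x ≠ x).card ≤
        (Finset.univ.filter fun x => g x = f x ∧ f x ≠ x).card := by
    have hfin : {g | P g}.Finite := Set.toFinite _
    obtain ⟨g, h1, h2⟩ := hfin.exists_maximalFor
      (fun g => (Finset.univ.filter fun x => g x = f x ∧ f x ≠ x).card) _ ⟨g, hg, hlt⟩
    refine ⟨g, h1, fun g' h' => ?_⟩
    by_contra! hc
    exact absurd (h2 h' hc.le) (not_le.2 hc)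
  have hsub : ∀ x, f x ≠ x → g x ≠ x := by
    intro v hv hgv
    have hadj := hf.adj v hv
    have hs := hg.rematch_eq_self hadj.ne
    have h1 := hf.invol
    have h2 := hg.invol
    -- Exchanging an edge of `g` for the edge from `v` to `f v` gains agreement at `v`. Nothing is
    -- lost: the edge removed at `f v` is not an edge of `f`, since the `f`-partner `v` is exposed
    -- by `g`.
    have hlt' : (Finset.univ.filter fun x => g x = f x ∧ f x ≠ x).card <
        (Finset.univ.filter fun x => _root_.rematch g v (f v) x = f x ∧ f x ≠ x).card := by
      apply Finset.card_lt_card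
      refine (Finset.ssubset_iff_of_subset ?_).2 ⟨v, ?_, ?_⟩
      · intro x hx
        simp only [Finset.mem_filter, Finset.mem_univ, true_and] at hx ⊢
        unfold _root_.rematch
        grind
      · rw [Finset.mem_filter]
        exact ⟨Finset.mem_univ _, by simp [_root_.rematch], hv⟩
      · simp only [Finset.mem_filter, Finset.mem_univ, true_and]
        grind
    refine absurd (hbest _ ⟨hg.rematch hgv hadj, hlt.trans_le ?_⟩) (not_le.2 hlt')
    by_cases hw : g (f v) = f v
    · apply Finset.card_le_card
      intro x hx
      simp only [Finset.mem_filter, Finset.mem_univ, true_and] at hx ⊢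
      rw [Ne, hs]
      grind
    -- The exchange uncovers only `g (f v)`, and the newly covered `v` takes its place in the count.
    · refine Finset.card_le_card_of_injOn (fun x => if x = g (f v) then v else x) ?_ ?_
      · intro x hx
        simp only [Finset.coe_filter, Finset.mem_univ, true_and, Set.mem_ofPred_eq] at hx ⊢
        rw [Ne, hs]
        grind
      · intro x hx y hy
        simp only [Finset.coe_filter, Finset.mem_univ, true_and, Set.mem_ofPred_eq] at hx hy
        grind
  obtain ⟨r, hr, hr'⟩ := Finset.exists_mem_notMem_of_card_lt_card hlt
  simp only [Finset.mem_filter, Finset.mem_univ, true_and, not_not] at hr hr'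
  exact hr (hmax r hr' g hg hsub)

end IsMate

/-! ### Alternating trees with witness matchings -/

/-- A stage of the search for an augmenting path. The vertices are outer, inner, or not yet reached;
`anc x a` tells that `a` was an inner vertex above `x` when `x` was reached; for an outer vertex `v`,
`wit v` is a matching that covers the root instead of `v`. -/
structure Search (V : Type*) where
  outer : V → Prop
  inner : V → Prop
  anc : V → V → Prop
  wit : V → V → V

namespace Search

variable {V : Type*}

/-- The invariant of the search from the exposed vertex `r`, for the matching `M`. -/
structure Inv (G : SimpleGraph V) (M : V → V) (r : V) (S : Search V) : Prop where
  mate : IsMate G M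
  root_exposed : M r = r
  root_outer : S.outer r
  disjoint : ∀ x, S.outer x → ¬ S.inner x
  mate_reached : ∀ x, S.outer x ∨ S.inner x → S.outer (M x) ∨ S.inner (M x)
  reached_exposed : ∀ x, S.outer x ∨ S.inner x → M x = x → x = r
  inner_mate : ∀ a, S.inner a → S.outer (M a)
  wit_mate : ∀ v, S.outer v → IsMate G (S.wit v)
  wit_fix : ∀ v, S.outer v → ∀ x, S.wit v x = x ↔ x = v ∨ (M x = x ∧ x ≠ r)
  wit_eq : ∀ v, S.outer v → ∀ x, ¬ S.outer x → ¬ S.inner x → S.wit v x = M x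
  anc_reached : ∀ x a, S.anc x a → (S.outer x ∨ S.inner x) ∧ (S.outer a ∨ S.inner a)
  anc_irrefl : ∀ a, S.inner a → ¬ S.anc a a
  anc_root : ∀ a, ¬ S.anc r a
  anc_mate : ∀ a, S.inner a → S.anc (M a) a
  anc_closed : ∀ a x, S.inner a → S.anc x a → S.anc (M x) a ∨ M x = a
  -- Let `T` be the set below an inner vertex `a`. A witness for a vertex in `T` maps `T` to itself;
  -- a witness for a vertex outside `T` agrees with `M` on `T` and at `a`. These two rules allow two
  -- witnesses to be glued along `T`. The last two fields make the sets below inner vertices a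
  -- laminar family.
  wit_in : ∀ a v x, S.inner a → S.outer v → S.anc v a → S.anc x a → S.anc (S.wit v x) a
  wit_out : ∀ a v x, S.inner a → S.outer v → ¬ S.anc v a → S.anc x a ∨ x = a → S.wit v x = M x
  anc_trans : ∀ a a' x, S.inner a → S.inner a' → S.anc a a' → S.anc x a → S.anc x a'
  anc_chain : ∀ a a' x, S.inner a → S.inner a' → S.anc x a → S.anc x a' →
    a = a' ∨ S.anc a a' ∨ S.anc a' a

/-- The search from `r` before its first step. -/
def init (M : V → V) (r : V) : Search V where
  outer x := x = r
  inner _ := False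
  anc _ _ := False
  wit _ := M

theorem inv_init {G : SimpleGraph V} {M : V → V} {r : V} (hM : IsMate G M) (hr : M r = r) :
    Inv G M r (init M r) := by
  constructor <;> simp [init, hM, hr]
  · intro x
    by_cases h : x = r <;> simp [h, hr]

open Classical in
/-- Add the matching edge of the new vertex `w`, reached from the outer vertex `v`. -/
noncomputable def grow (M : V → V) (S : Search V) (v w : V) : Search V where
  outer x := S.outer x ∨ x = M w
  inner x := S.inner x ∨ x = w
  anc x a := if x = w then S.anc v a else if x = M w then S.anc v a ∨ a = w else S.anc x a
  wit x := if x = M w then rematch (S.wit v) v w else S.wit x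

open Classical in
/-- The witness of the inner vertex `a` after a blossom has been closed by an edge `pq` such that
`a` is above `p` and not above `q`. -/
noncomputable def mergeWit (S : Search V) (p q a x : V) : V :=
  if x = a then a else if x = p then q else if x = q then p else
    if S.anc x a then S.wit p x else S.wit q x

open Classical in
/-- Close the blossom of the edge `vw`, where `v` and `w` are outer. -/
noncomputable def merge (S : Search V) (v w : V) : Search V where
  outer x := S.outer x ∨ (S.inner x ∧ ¬ (S.anc v x ↔ S.anc w x))
  inner x := S.inner x ∧ (S.anc v x ↔ S.anc w x)
  anc := S.anc
  wit x := if S.outer x then S.wit x else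
    if S.anc v x then S.mergeWit v w x else S.mergeWit w v x

variable {G : SimpleGraph V} {M : V → V} {r : V} {S : Search V}

/-- Since `w` is unreached, `wit v` still matches it with `M w`. Exchanging that edge for `vw`
covers `v` and exposes `M w`, which gives the new witness. The set below the new inner vertex `w`
consists of `M w` alone. -/
theorem Inv.grow (h : Inv G M r S) {v w : V} (hv : S.outer v) (hvw : G.Adj v w)
    (ho : ¬ S.outer w) (hi : ¬ S.inner w) (hw : M w ≠ w) : Inv G M r (S.grow M v w) := by
  classical
  have hMM := h.mate.invol
  have hxo : ¬ S.outer (M w) := fun hc => by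
    have := h.mate_reached _ (.inl hc); rw [hMM] at this; tauto
  have hxi : ¬ S.inner (M w) := fun hc => by
    have := h.mate_reached _ (.inr hc); rw [hMM] at this; tauto
  have hvv : S.wit v v = v := (h.wit_fix v hv v).2 (.inl rfl)
  have hww : S.wit v w = M w := h.wit_eq v hv w ho hi
  have hvne : v ≠ w := hvw.ne
  have hvx : v ≠ M w := fun hc => hxo (hc ▸ hv)
  have hancw : ∀ a, ¬ S.anc w a := fun a hc => by have := h.anc_reached _ _ hc; tauto
  have hancx : ∀ a, ¬ S.anc (M w) a := fun a hc => by have := h.anc_reached _ _ hc; tauto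
  have hrw : r ≠ w := fun hc => ho (hc ▸ h.root_outer)
  have hrx : r ≠ M w := fun hc => hxo (hc ▸ h.root_outer)
  have hinj : ∀ x y, M x = M y → x = y := fun x y e => h.mate.injective e
  obtain ⟨h1, h2, h3, h4, h5, h6, h7, h8, h9, h10, h11, h12, h13, h14, h15, h16, h17, h18, h19⟩ := h
  have hMw : ∀ x, x = M w ↔ M x = w := fun x => by grind
  have hancw' : ∀ x, ¬ S.anc x w := fun x hc => by have := h11 _ _ hc; tauto
  have hM : ∀ a x, S.anc x a → ¬ S.outer x → S.inner x := fun a x hx => by have := h11 _ _ hx; tauto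
  -- Relative to the old inner vertices, `w` and `M w` are copies of `v`, so the old properties
  -- transfer.
  have hanc : ∀ x a, S.inner a →
      ((S.grow M v w).anc x a ↔ S.anc (if x = w ∨ x = M w then v else x) a) := by
    intro x a ha
    have : a ≠ w := fun e => hi (e ▸ ha)
    by_cases hx : x = w
    · simp [Search.grow, hx]
    · by_cases hx' : x = M w <;> simp [Search.grow, hx, hx', this, hw]
  have hancn : ∀ x, (S.grow M v w).anc x w ↔ x = M w := by
    intro x
    by_cases hx : x = w
    · simp [Search.grow, hx, hancw', hw.symm]
    · by_cases hx' : x = M w <;> simp [Search.grow, hx, hx', hancw', hw]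
  have hne : ∀ a, S.inner a → ¬ (a = w ∨ a = M w) := by
    rintro a ha (rfl | rfl)
    exacts [hi ha, hxi ha]
  have hanc' : ∀ x a, S.inner x → S.inner a → ((S.grow M v w).anc x a ↔ S.anc x a) := by
    intro x a hx ha
    rw [hanc x a ha, if_neg (hne x hx)]
  have hwit : ∀ u, u ≠ M w → (S.grow M v w).wit u = S.wit u := fun u hu => by
    simp [Search.grow, hu]
  have hwitn : ∀ x, (S.grow M v w).wit (M w) x =
      if x = v then w else if x = w then v else if x = M w then x else S.wit v x := fun x => by
    simp [Search.grow, rematch, hww]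
  have hinn : ∀ a, (S.grow M v w).inner a ↔ S.inner a ∨ a = w := fun a => Iff.rfl
  have hout : ∀ a, (S.grow M v w).outer a ↔ S.outer a ∨ a = M w := fun a => Iff.rfl
  constructor
  · exact h1
  · exact h2
  · exact .inl h3
  · intro x
    rw [hout, hinn]
    have := h4 x
    grind only
  · intro x
    simp only [hout, hinn]
    have := h5 x
    have := hMw (M x)
    grind only
  · intro x
    rw [hout, hinn]
    have := h6 x
    grind only
  · intro a
    rw [hout, hinn]
    have := h7 a
    grind only
  · intro u hu
    by_cases hux : u = M w
    · simpa [Search.grow, hux] using (h8 v hv).rematch hvv hvw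
    · simpa [Search.grow, hux] using h8 u (hu.resolve_right hux)
  · intro u hu x
    by_cases hux : u = M w
    · simp only [Search.grow, hux, if_true]
      rw [(h8 v hv).rematch_eq_self hvne, h9 v hv x, hww]
      grind
    · simpa [Search.grow, hux] using h9 u (hu.resolve_right hux) x
  · intro u hu x hx hx'
    rw [hout] at hu hx
    rw [hinn] at hx'
    by_cases hux : u = M w
    · rw [hux, hwitn]
      have := h10 v hv x
      grind only
    · rw [hwit u hux]
      exact h10 u (hu.resolve_right hux) x (by tauto) (by tauto)
  · intro x a hx
    simp only [hout, hinn]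
    have h11v := h11 v a
    have h11x := h11 x a
    simp only [Search.grow] at hx
    grind only
  · intro a ha
    rcases (hinn a).1 ha with ha | rfl
    · rw [hanc' _ _ ha ha]
      exact h12 a ha
    · rw [hancn]
      exact hw.symm
  · intro a ha
    simp only [Search.grow, hrw, hrx, if_false] at ha
    exact h13 a ha
  · intro a ha
    rcases (hinn a).1 ha with ha | rfl
    · rw [hanc _ _ ha, if_neg]
      · exact h14 a ha
      · rintro (e | e)
        · exact hxi (by rwa [← e, hMM])
        · exact hi (by rwa [← hinj _ _ e])
    · rw [hancn]
  · intro a x ha hx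
    rcases (hinn a).1 ha with ha | rfl
    · rw [hanc _ _ ha] at hx ⊢
      have := h15 a x ha
      grind only
    · rw [hancn] at hx ⊢
      grind only
  · intro a u x ha hu hua hx
    rcases (hinn a).1 ha with ha | rfl
    · rw [hanc _ _ ha] at hua hx ⊢
      by_cases hux : u = M w
      · rw [hux, hwitn]
        have := h16 a v x ha hv
        grind only
      · rw [hwit u hux]
        have := h16 a u x ha (hu.resolve_right hux)
        have := h10 u (hu.resolve_right hux) w ho hi
        have := h10 u (hu.resolve_right hux) (M w) hxo hxi
        grind only
    · rw [hancn] at hua hx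
      rw [hancn, hua, hwitn, hx, if_neg hvx.symm, if_neg hw, if_pos rfl]
  · intro a u x ha hu hua hx
    rcases (hinn a).1 ha with ha | rfl
    · rw [hanc _ _ ha] at hua hx
      by_cases hux : u = M w
      · rw [hux, hwitn]
        have := h17 a v x ha hv
        grind only
      · rw [hwit u hux]
        have := h17 a u x ha (hu.resolve_right hux)
        have := h10 u (hu.resolve_right hux) w ho hi
        have := h10 u (hu.resolve_right hux) (M w) hxo hxi
        grind only
    · rw [hancn] at hua hx
      rw [hwit u hua]
      have := h10 u (hu.resolve_right hua) a ho hi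
      have := h10 u (hu.resolve_right hua) (M a) hxo hxi
      grind only
  · intro a a' x ha ha' haa hx
    rcases (hinn a').1 ha' with hb' | rfl
    · rcases (hinn a).1 ha with hb | rfl
      · rw [hanc' _ _ hb hb'] at haa
        rw [hanc _ _ hb']
        rw [hanc _ _ hb] at hx
        exact h18 a a' _ hb hb' haa hx
      · rw [hanc _ _ hb', if_pos (.inl rfl)] at haa
        rw [hancn] at hx
        rwa [hanc _ _ hb', if_pos (.inr hx)]
    · rw [hancn] at haa
      rcases (hinn a).1 ha with hb | rfl
      · exact absurd (haa ▸ hb) hxi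
      · exact absurd haa hw.symm
  · intro a a' x ha ha' hx hx'
    rcases (hinn a').1 ha' with hb' | rfl
    · rcases (hinn a).1 ha with hb | rfl
      · rw [hanc _ _ hb] at hx
        rw [hanc _ _ hb'] at hx'
        rw [hanc' _ _ hb hb', hanc' _ _ hb' hb]
        exact h19 a a' _ hb hb' hx hx'
      · rw [hanc _ _ hb'] at hx'
        rw [hancn] at hx
        rw [if_pos (.inr hx)] at hx'
        exact .inr (.inl (by rwa [hanc _ _ hb', if_pos (.inl rfl)]))
    · rcases (hinn a).1 ha with hb | rfl
      · rw [hanc _ _ hb] at hx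
        rw [hancn] at hx'
        rw [if_pos (.inr hx')] at hx
        exact .inr (.inr (by rwa [hanc _ _ hb, if_pos (.inl rfl)]))
      · exact .inl rfl

/-- Let `a` be above one end `p` of the edge but not above the other end `q`. Use `wit p` below `a`,
`wit q` elsewhere, and the edge `pq`. Both parts are closed: `wit p` preserves the set below `a`,
and `wit q` agrees with `M` on it and at `a`. As `wit q` would match `a` into that set, the glued
matching exposes `a`, while `p` and `q` become covered. Only old witnesses enter, so all such `a`
can be treated at once. -/
theorem Inv.merge (h : Inv G M r S) {v w : V} (hv : S.outer v) (hw : S.outer w)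
    (hvw : G.Adj v w) : Inv G M r (S.merge v w) := by
  classical
  have key : ∀ p q a, S.outer p → S.outer q → G.Adj p q → S.inner a → S.anc p a → ¬ S.anc q a →
      (∀ a', (S.merge v w).inner a' → (S.anc p a' ↔ S.anc q a')) →
      IsMate G (S.mergeWit p q a) ∧
      (∀ x, S.mergeWit p q a x = x ↔ x = a ∨ (M x = x ∧ x ≠ r)) ∧
      (∀ x, ¬ S.outer x → ¬ S.inner x → S.mergeWit p q a x = M x) ∧
      (∀ a' x, (S.merge v w).inner a' → S.anc a a' → S.anc x a' →
        S.anc (S.mergeWit p q a x) a') ∧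
      (∀ a' x, (S.merge v w).inner a' → ¬ S.anc a a' → S.anc x a' ∨ x = a' →
        S.mergeWit p q a x = M x) := by
    intro p q a hp hq hpq ha hpa hqa hpq'
    have hMM := h.mate.invol
    have hne : p ≠ q := hpq.ne
    have hap : a ≠ p := fun e => h.disjoint p hp (e ▸ ha)
    have haq : a ≠ q := fun e => h.disjoint q hq (e ▸ ha)
    have haa := h.anc_irrefl a ha
    have hP := h.wit_mate p hp
    have hQ := h.wit_mate q hq
    have hpp : S.wit p p = p := (h.wit_fix p hp p).2 (.inl rfl)
    have hqq : S.wit q q = q := (h.wit_fix q hq q).2 (.inl rfl)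
    have hPin := fun x => h.wit_in a p x ha hp hpa
    have hQa : S.wit q a = M a := h.wit_out a q a ha hq hqa (.inr rfl)
    have hQM := fun x => h.wit_out a q x ha hq hqa
    have hQin : ∀ x, S.anc x a ∨ x = a → S.anc (S.wit q x) a ∨ S.wit q x = a := by
      intro x hx
      rw [hQM x hx]
      rcases hx with hx | rfl
      · exact h.anc_closed a x ha hx
      · exact .inl (h.anc_mate _ ha)
    have hQout : ∀ x, ¬ S.anc x a → x ≠ a → ¬ S.anc (S.wit q x) a ∧ S.wit q x ≠ a := by
      intro x hx hxa
      have := hQin (S.wit q x)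
      rw [hQ.invol] at this
      tauto
    have hPf := h.wit_fix p hp
    have hQf := h.wit_fix q hq
    have hpi := h.disjoint p hp
    have hqi := h.disjoint q hq
    have hm : ∀ a', (S.merge v w).inner a' → S.inner a' := fun a' h' => h'.1
    have hMa : M a ≠ a := fun e => haa (by have := h.anc_mate a ha; rwa [e] at this)
    have har : a ≠ r := fun e => h.disjoint r h.root_outer (e ▸ ha)
    refine ⟨⟨?_, ?_⟩, ?_, ?_, ?_, ?_⟩
    · intro x
      have h1 := hP.invol x
      have h2 := hQ.invol x
      have h3 := hPin x
      have h4 := hQout x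
      unfold mergeWit
      clear hPf hQf hQM hQin hPin hQout hm
      grind only
    · intro x
      have h1 := hP.adj x
      have h2 := hQ.adj x
      have h3 := hpq.symm
      unfold mergeWit
      clear hPf hQf hQM hQin hPin hQout hm
      grind only
    · intro x
      have h1 := hPf x
      have h2 := hQf x
      have h3 := h.reached_exposed p (.inl hp)
      have h4 := h.reached_exposed q (.inl hq)
      unfold mergeWit
      clear hPf hQf hQM hQin hPin hQout hm
      grind only
    · intro x ho hi
      have h1 := h.wit_eq p hp x ho hi
      have h2 := h.wit_eq q hq x ho hi
      have h3 : ¬ S.anc x a := fun hc => (h.anc_reached _ _ hc).1.elim ho hi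
      unfold mergeWit
      clear hPf hQf hQM hQin hPin hQout hm
      grind only
    · intro a' x ha' haa' hx
      have h1 := hpq' a' ha'
      have h2 := h.anc_trans a a' p ha (hm _ ha') haa' hpa
      have h3 := h.wit_in a' p x (hm _ ha') hp h2 hx
      have h4 := h.wit_in a' q x (hm _ ha') hq (h1.1 h2) hx
      unfold mergeWit
      clear hPf hQf hQM hQin hPin hQout hm
      grind only
    · intro a' x ha' haa' hx
      have hi := hm _ ha'
      have h1 := hpq' a' ha'
      have hne' : a ≠ a' := fun e => hqa (e ▸ (h1.1 (e ▸ hpa)))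
      -- If `a'` were above `p`, laminarity would leave only the case that `a` is above `a'`. But
      -- `a'` stays inner, so it would be above `q` as well, and then so would `a`.
      have h2 : ¬ S.anc p a' := fun hc => by
        rcases h.anc_chain a a' p ha hi hpa hc with e | e | e
        · exact hne' e
        · exact haa' e
        · exact hqa (h.anc_trans a' a q hi ha e (h1.1 hc))
      have h3 := h.wit_out a' p x hi hp h2 hx
      have h4 := h.wit_out a' q x hi hq (fun hc => h2 (h1.2 hc)) hx
      unfold mergeWit
      clear hPf hQf hQM hQin hPin hQout hm
      grind only
  have key' : ∀ a, S.inner a → ¬ (S.anc v a ↔ S.anc w a) →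
      IsMate G ((S.merge v w).wit a) ∧
      (∀ x, (S.merge v w).wit a x = x ↔ x = a ∨ (M x = x ∧ x ≠ r)) ∧
      (∀ x, ¬ S.outer x → ¬ S.inner x → (S.merge v w).wit a x = M x) ∧
      (∀ a' x, (S.merge v w).inner a' → S.anc a a' → S.anc x a' →
        S.anc ((S.merge v w).wit a x) a') ∧
      (∀ a' x, (S.merge v w).inner a' → ¬ S.anc a a' → S.anc x a' ∨ x = a' →
        (S.merge v w).wit a x = M x) := by
    intro a ha hne
    have ho : ¬ S.outer a := fun hc => h.disjoint a hc ha
    by_cases hva : S.anc v a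
    · have : (S.merge v w).wit a = S.mergeWit v w a := by simp [Search.merge, ho, hva]
      rw [this]
      exact key v w a hv hw hvw ha hva (by tauto) fun a' h' => h'.2
    · have : (S.merge v w).wit a = S.mergeWit w v a := by simp [Search.merge, ho, hva]
      rw [this]
      exact key w v a hw hv hvw.symm ha (by tauto) hva fun a' h' => h'.2.symm
  have hold : ∀ u, S.outer u → (S.merge v w).wit u = S.wit u := fun u hu => by
    simp [Search.merge, hu]
  clear key
  obtain ⟨h1, h2, h3, h4, h5, h6, h7, h8, h9, h10, h11, h12, h13, h14, h15, h16, h17, h18, h19⟩ := h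
  have hre : ∀ x, (S.merge v w).outer x ∨ (S.merge v w).inner x ↔ S.outer x ∨ S.inner x := by
    intro x
    simp only [Search.merge]
    tauto
  constructor
  · exact h1
  · exact h2
  · exact .inl h3
  · intro x hx hx'
    rcases hx with hx | hx
    · exact h4 x hx hx'.1
    · exact hx.2 hx'.2
  · intro x
    rw [hre, hre]
    exact h5 x
  · intro x
    rw [hre]
    exact h6 x
  · exact fun a ha => .inl (h7 a ha.1)
  · rintro u (hu | hu)
    · rw [hold u hu]
      exact h8 u hu
    · exact (key' u hu.1 hu.2).1
  · rintro u (hu | hu)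
    · rw [hold u hu]
      exact h9 u hu
    · exact (key' u hu.1 hu.2).2.1
  · intro u hu x hx hx'
    have : ¬ (S.outer x ∨ S.inner x) := by
      rw [← hre]
      tauto
    rw [not_or] at this
    rcases hu with hu | hu
    · rw [hold u hu]
      exact h10 u hu x this.1 this.2
    · exact (key' u hu.1 hu.2).2.2.1 x this.1 this.2
  · intro x a
    rw [hre, hre]
    exact h11 x a
  · exact fun a ha => h12 a ha.1
  · exact h13
  · exact fun a ha => h14 a ha.1
  · exact fun a x ha => h15 a x ha.1
  · intro a u x ha hu
    rcases hu with hu | hu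
    · rw [hold u hu]
      exact h16 a u x ha.1 hu
    · exact (key' u hu.1 hu.2).2.2.2.1 a x ha
  · intro a u x ha hu
    rcases hu with hu | hu
    · rw [hold u hu]
      exact h17 a u x ha.1 hu
    · exact (key' u hu.1 hu.2).2.2.2.2 a x ha
  · exact fun a a' x ha ha' => h18 a a' x ha.1 ha'.1
  · exact fun a a' x ha ha' => h19 a a' x ha.1 ha'.1

/-- No rule applies to the pair `(v, w)`. -/
def ClosedAt (G : SimpleGraph V) (S : Search V) (v w : V) : Prop :=
  S.outer v → G.Adj v w →
    S.inner w ∨ (S.outer w ∧ ∀ a, S.inner a → (S.anc v a ↔ S.anc w a))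

/-- The ones over `K` cancel in pairs modulo 2. -/
theorem even_card_of_involution {K : Finset V} {f : V → V} (hK : ∀ x ∈ K, f x ∈ K)
    (hne : ∀ x ∈ K, f x ≠ x) (hf : ∀ x, f (f x) = x) : Even K.card := by
  have h := Finset.sum_involution (s := K) (f := fun _ => (1 : ZMod 2)) (fun x _ => f x)
    (fun _ _ => by decide) (fun x hx _ => hne x hx) hK (fun x _ => hf x)
  simp only [Finset.sum_const, nsmul_eq_mul, mul_one] at h
  exact (ZMod.natCast_eq_zero_iff_even).1 h

/-- A closed search proves that no matching covers all outer vertices. -/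
theorem Inv.not_covered [Fintype V] (h : Inv G M r S) (hcl : ∀ v w, ClosedAt G S v w) {g : V → V}
    (hg : IsMate G g) : ∃ x, S.outer x ∧ g x = x := by
  classical
  by_contra! hcov
  -- These classes play the role of contracted blossoms. The vertex `M y` is the base of the class
  -- of `y`, where `y` is an inner vertex or the root.
  let cls : V → Finset V := fun y =>
    Finset.univ.filter fun z => S.outer z ∧ ∀ a, S.inner a → (S.anc z a ↔ S.anc (M y) a)
  let T : Finset V := Finset.univ.filter fun y => y = r ∨ S.inner y
  have hMo : ∀ y ∈ T, S.outer (M y) := by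
    intro y hy
    rcases (Finset.mem_filter.1 hy).2 with rfl | hy
    · rw [h.root_exposed]
      exact h.root_outer
    · exact h.inner_mate y hy
  have hMM := h.mate.invol
  have huniq : ∀ y ∈ T, ∀ y' ∈ T, (∀ a, S.inner a → (S.anc (M y) a ↔ S.anc (M y') a)) →
      y = y' := by
    intro y hy y' hy' hyy
    have h1 := h.anc_root
    rcases (Finset.mem_filter.1 hy).2 with rfl | hi <;>
      rcases (Finset.mem_filter.1 hy').2 with rfl | hi'
    · rfl
    · have := (hyy _ hi').2 (h.anc_mate _ hi')
      rw [h.root_exposed] at this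
      exact absurd this (h1 _)
    · have := (hyy _ hi).1 (h.anc_mate _ hi)
      rw [h.root_exposed] at this
      exact absurd this (h1 _)
    · by_contra hne
      have h2 := (hyy _ hi').2 (h.anc_mate _ hi')
      have h3 := (hyy _ hi).1 (h.anc_mate _ hi)
      have h4 := h.anc_closed _ _ hi' h2
      have h5 := h.anc_closed _ _ hi h3
      rw [hMM] at h4 h5
      have h4 := h4.resolve_right hne
      have h5 := h5.resolve_right (Ne.symm hne)
      exact h.anc_irrefl _ hi (h.anc_trans _ _ _ hi' hi h5 h4)
  -- Apart from its base, a class is paired off by `M`: if `M z` were inner, `z` would be the base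
  -- of its own class.
  have hodd : ∀ y ∈ T, Odd (cls y).card := by
    intro y hy
    have hmem : M y ∈ cls y := by simp [cls, hMo y hy]
    rw [← Finset.card_erase_add_one hmem]
    refine Even.add_one (even_card_of_involution (f := M) ?_ ?_ hMM)
    · intro z hz
      simp only [cls, Finset.mem_erase, Finset.mem_filter, Finset.mem_univ, true_and] at hz ⊢
      obtain ⟨hzy, hzo, hza⟩ := hz
      have hzr : z ≠ r := by
        rintro rfl
        refine hzy ?_
        rw [← huniq z (by simp [T]) y hy (by rwa [h.root_exposed]), h.root_exposed]
      have hMi : ¬ S.inner (M z) := fun hc => hzy (by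
        rw [← huniq (M z) (by simp [T, hc]) y hy (by rwa [hMM]), hMM])
      refine ⟨fun e => hzr ?_, (h.mate_reached z (.inl hzo)).resolve_right hMi, ?_⟩
      · have hzy' := h.mate.injective e
        subst hzy'
        rcases (Finset.mem_filter.1 hy).2 with e | e
        · exact e
        · exact absurd e (h.disjoint _ hzo)
      · intro a ha
        rw [← hza a ha]
        have hza' : z ≠ a := fun e => h.disjoint z hzo (e ▸ ha)
        have hMa : M z ≠ a := fun e => hMi (e ▸ ha)
        have h1 := h.anc_closed a z ha
        have h2 := h.anc_closed a (M z) ha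
        rw [hMM] at h2
        tauto
    · intro z hz e
      simp only [cls, Finset.mem_erase, Finset.mem_filter, Finset.mem_univ, true_and] at hz
      obtain ⟨hzy, hzo, hza⟩ := hz
      have hzr := h.reached_exposed z (.inl hzo) e
      refine hzy ?_
      rw [← huniq z (by simp [T, hzr]) y hy (by rwa [e]), e]
  -- An odd class is not a union of edges of `g`. By closedness, an edge of `g` that leaves the
  -- class can only end at an inner vertex.
  have hleave : ∀ y ∈ T, ∃ z ∈ cls y, S.inner (g z) := by
    intro y hy
    by_contra! hno
    refine (Nat.not_even_iff_odd.2 (hodd y hy)) (even_card_of_involution (f := g) ?_ ?_ hg.invol)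
    · intro z hz
      have hi := hno z hz
      simp only [cls, Finset.mem_filter, Finset.mem_univ, true_and] at hz ⊢
      have hc := (hcl z (g z) hz.1 (hg.adj z (hcov z hz.1))).resolve_left hi
      exact ⟨hc.1, fun a ha => (hc.2 a ha).symm.trans (hz.2 a ha)⟩
    · intro z hz
      simp only [cls, Finset.mem_filter, Finset.mem_univ, true_and] at hz
      exact hcov z hz.1
  choose! z hz hzi using hleave
  have hrT : r ∈ T := by simp [T]
  -- The exits go to distinct inner vertices, but there is one more class than there are inner
  -- vertices.
  have hle : T.card ≤ (T.erase r).card := by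
    refine Finset.card_le_card_of_injOn (fun y => g (z y)) ?_ ?_
    · intro y hy
      have hi := hzi y hy
      simp only [T, Finset.coe_erase, Finset.coe_filter, Finset.mem_univ, true_and]
      refine ⟨.inr hi, fun e => ?_⟩
      rw [Set.mem_singleton_iff] at e
      exact h.disjoint r h.root_outer (e ▸ hi)
    · intro y hy y' hy' e
      have h1 := hg.injective e
      have h2 := (Finset.mem_filter.1 (hz y hy)).2.2
      have h3 := (Finset.mem_filter.1 (hz y' hy')).2.2
      rw [← h1] at h3
      exact huniq y hy y' hy' fun a ha => (h2 a ha).symm.trans (h3 a ha)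
  exact absurd hle (not_le.2 (Finset.card_erase_lt_of_mem hrT))

end Search

/-! ### Programs with bounded loops -/

namespace RAM

/-- The state with a new value of one variable. -/
def State.setVar (s : State) (x c : ℕ) : State := { s with var := Function.update s.var x c }

/-- The state with a new value of one array entry. -/
def State.setArr (s : State) (k i c : ℕ) : State :=
  { s with arr := Function.update s.arr k (Function.update (s.arr k) i c) }

section
variable (s : State) (x y k l i j c : ℕ)

@[simp] theorem State.setVar_var : (s.setVar x c).var y = if y = x then c else s.var y := by
  simp [State.setVar, Function.update_apply]

@[simp] theorem State.setVar_arr : (s.setVar x c).arr = s.arr := rfl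

@[simp] theorem State.setArr_var : (s.setArr k i c).var = s.var := rfl

@[simp] theorem State.setArr_arr :
    (s.setArr k i c).arr l j = if l = k ∧ j = i then c else s.arr l j := by
  by_cases h : l = k
  · subst h
    simp [State.setArr, Function.update_apply]
  · simp [State.setArr, h]

end

/-- Programs in which every loop runs its counter through the numbers below the variable `0`. -/
inductive Cmd where
  | skip
  | assign (x : ℕ) (e : Expr)
  | store (k : ℕ) (i e : Expr)
  | seq (p q : Cmd)
  | ite (e : Expr) (p q : Cmd)
  | forn (x : ℕ) (p : Cmd)

/-- Sequential composition. -/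
infixr:60 " ;; " => Cmd.seq

namespace Cmd

/-- Translation to programs of the machine. -/
def toProg : Cmd → Prog
  | skip => .skip
  | assign x e => .assign x e
  | store k i e => .store k i e
  | seq p q => .seq p.toProg q.toProg
  | ite e p q => .ite e p.toProg q.toProg
  | forn x p => .seq (.assign x (.lit 0))
      (.loop (.sub (.var 0) (.var x)) (.seq p.toProg (.assign x (.add (.var x) (.lit 1)))))

/-- The final state. -/
def run : Cmd → State → State
  | skip, s => s
  | assign x e, s => s.setVar x (e.eval s)
  | store k i e, s => s.setArr k (i.eval s) (e.eval s)
  | seq p q, s => q.run (p.run s)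
  | ite e p q, s => if e.eval s ≠ 0 then p.run s else q.run s
  | forn x p, s =>
      (Nat.rec s (fun i s' => p.run (s'.setVar x i)) (s.var 0) : State).setVar x (s.var 0)

/-- The variables that may change. -/
def writes : Cmd → ℕ → Bool
  | skip, _ => false
  | assign x _, y => x == y
  | store _ _ _, _ => false
  | seq p q, y => p.writes y || q.writes y
  | ite _ p q, y => p.writes y || q.writes y
  | forn x p, y => x == y || p.writes y

/-- The arrays that may change. -/
def stores : Cmd → ℕ → Bool
  | skip, _ => false
  | assign _ _, _ => false
  | store k _ _, l => k == l
  | seq p q, l => p.stores l || q.stores l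
  | ite _ p q, l => p.stores l || q.stores l
  | forn _ p, l => p.stores l

/-- Loop bodies change neither the counter nor the bound. -/
def ok : Cmd → Bool
  | skip => true
  | assign _ _ => true
  | store _ _ _ => true
  | seq p q => p.ok && q.ok
  | ite _ p q => p.ok && q.ok
  | forn x p => x != 0 && !p.writes x && !p.writes 0 && p.ok

/-- A bound on the number of steps, as a polynomial in the value of the variable `0`. -/
noncomputable def time : Cmd → Polynomial ℕ
  | skip => 1
  | assign _ e => .C (e.cost + 1)
  | store _ i e => .C (i.cost + e.cost + 1)
  | seq p q => p.time + q.time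
  | ite e p q => .C (e.cost + 1) + p.time + q.time
  | forn _ p => 6 + .X * (p.time + 8)

theorem run_var (p : Cmd) {y : ℕ} (h : p.writes y = false) (s : State) :
    (p.run s).var y = s.var y := by
  induction p generalizing s with
  | skip => rfl
  | assign x e =>
    simp only [writes, beq_eq_false_iff_ne] at h
    simp [run, h.symm]
  | store k i e => rfl
  | seq p q hp hq =>
    simp only [writes, Bool.or_eq_false_iff] at h
    rw [run, hq h.2, hp h.1]
  | ite e p q hp hq =>
    simp only [writes, Bool.or_eq_false_iff] at h
    rw [run]
    split
    exacts [hp h.1 s, hq h.2 s]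
  | forn x p hp =>
    simp only [writes, Bool.or_eq_false_iff, beq_eq_false_iff_ne] at h
    rw [run, State.setVar_var, if_neg h.1.symm]
    induction s.var 0 with
    | zero => rfl
    | succ i ih => rw [hp h.2, State.setVar_var, if_neg h.1.symm, ih]

theorem run_arr (p : Cmd) {l : ℕ} (h : p.stores l = false) (s : State) :
    (p.run s).arr l = s.arr l := by
  induction p generalizing s with
  | skip => rfl
  | assign x e => rfl
  | store k i e =>
    simp only [stores, beq_eq_false_iff_ne] at h
    ext j
    simp [run, h.symm]
  | seq p q hp hq =>
    simp only [stores, Bool.or_eq_false_iff] at h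
    rw [run, hq h.2, hp h.1]
  | ite e p q hp hq =>
    simp only [stores, Bool.or_eq_false_iff] at h
    rw [run]
    split
    exacts [hp h.1 s, hq h.2 s]
  | forn x p hp =>
    rw [run, State.setVar_arr]
    induction s.var 0 with
    | zero => rfl
    | succ i ih => rw [hp h, State.setVar_arr, ih]

/-- A loop is verified by an invariant of its iterations. -/
theorem forn_induction {x : ℕ} {p : Cmd} (s : State) (I : ℕ → State → Prop) (h0 : I 0 s)
    (hx : x ≠ 0) (hw : p.writes 0 = false)
    (hstep : ∀ i s', i < s.var 0 → s'.var 0 = s.var 0 → I i s' → I (i + 1) (p.run (s'.setVar x i))) :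
    ∃ s', I (s.var 0) s' ∧ s'.var 0 = s.var 0 ∧ (forn x p).run s = s'.setVar x (s.var 0) := by
  have key : ∀ m ≤ s.var 0,
      I m (Nat.rec s (fun i s' => p.run (s'.setVar x i)) m : State) ∧
      (Nat.rec s (fun i s' => p.run (s'.setVar x i)) m : State).var 0 = s.var 0 := by
    intro m hm
    induction m with
    | zero => exact ⟨h0, rfl⟩
    | succ i ih =>
      obtain ⟨h1, h2⟩ := ih (by omega)
      refine ⟨hstep i _ (by omega) h2 h1, ?_⟩
      change (p.run _).var 0 = _
      rw [p.run_var hw, State.setVar_var, if_neg hx.symm, h2]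
  exact ⟨_, (key _ le_rfl).1, (key _ le_rfl).2, rfl⟩

theorem runs_toProg (p : Cmd) (hp : p.ok) (h0 : p.writes 0 = false) (s : State) :
    ∃ t, Runs p.toProg s t (p.run s) ∧ t ≤ p.time.eval (s.var 0) := by
  induction p generalizing s with
  | skip => exact ⟨1, .skip s, by simp [time]⟩
  | assign x e => exact ⟨_, .assign x e s, by simp [time]⟩
  | store k i e => exact ⟨_, .store k i e s, by simp [time]⟩
  | seq p q ihp ihq =>
    simp only [ok, Bool.and_eq_true, writes, Bool.or_eq_false_iff] at hp h0
    obtain ⟨t, h1, h2⟩ := ihp hp.1 h0.1 s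
    obtain ⟨t', h1', h2'⟩ := ihq hp.2 h0.2 (p.run s)
    refine ⟨_, .seq h1 h1', ?_⟩
    rw [p.run_var h0.1] at h2'
    simp only [time, Polynomial.eval_add]
    omega
  | ite e p q ihp ihq =>
    simp only [ok, Bool.and_eq_true, writes, Bool.or_eq_false_iff] at hp h0
    obtain ⟨t, h1, h2⟩ := ihp hp.1 h0.1 s
    obtain ⟨t', h1', h2'⟩ := ihq hp.2 h0.2 s
    by_cases he : e.eval s = 0
    · refine ⟨_, by rw [run, if_neg (not_not.2 he)]; exact .ite_false he h1', ?_⟩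
      simp only [time, Polynomial.eval_add, Polynomial.eval_C]
      omega
    · refine ⟨_, by rw [run, if_pos he]; exact .ite_true he h1, ?_⟩
      simp only [time, Polynomial.eval_add, Polynomial.eval_C]
      omega
  | forn x p ih =>
    simp only [ok, Bool.and_eq_true, writes, Bool.or_eq_false_iff, bne_iff_ne, ne_eq,
      Bool.not_eq_true'] at hp h0
    obtain ⟨⟨⟨hx, hpx⟩, hp0⟩, hpok⟩ := hp
    let F : ℕ → State := fun m => (Nat.rec s (fun i s' => p.run (s'.setVar x i)) m : State)
    have hF0 : ∀ m, (F m).var 0 = s.var 0 := by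
      intro m
      induction m with
      | zero => rfl
      | succ i hi =>
        change (p.run _).var 0 = _
        rw [p.run_var hp0, State.setVar_var, if_neg (Ne.symm hx), hi]
    -- Here `k` iterations remain. Each costs 4 for the test and 4 for the increment besides the
    -- body; the other 4 pays for the final failing test. Setting the counter to zero costs 2 more,
    -- hence the 6 in `time`.
    have key : ∀ k i, i + k = s.var 0 → ∃ t,
        Runs (.loop (.sub (.var 0) (.var x)) (.seq p.toProg (.assign x (.add (.var x) (.lit 1)))))
          ((F i).setVar x i) t ((F (s.var 0)).setVar x (s.var 0)) ∧
        t ≤ 4 + k * (p.time.eval (s.var 0) + 8) := by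
      intro k
      induction k with
      | zero =>
        intro i hi
        obtain rfl : i = s.var 0 := by omega
        refine ⟨_, .loop_false ?_, ?_⟩
        · simp [Expr.eval, Ne.symm hx, hF0]
        · simp [Expr.cost]
      | succ k hk =>
        intro i hi
        obtain ⟨t, h1, h2⟩ := ih hpok hp0 ((F i).setVar x i)
        obtain ⟨t', h1', h2'⟩ := hk (i + 1) (by omega)
        have hs : (p.run ((F i).setVar x i)).setVar x (i + 1) = (F (i + 1)).setVar x (i + 1) := rfl
        have ha := Runs.assign x (.add (.var x) (.lit 1)) (p.run ((F i).setVar x i))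
        change Runs _ _ _ ((p.run ((F i).setVar x i)).setVar x
          ((p.run ((F i).setVar x i)).var x + 1)) at ha
        rw [p.run_var hpx, State.setVar_var, if_pos rfl, hs] at ha
        refine ⟨_, .loop_true ?_ (.seq h1 ha) h1', ?_⟩
        · simp only [Expr.eval, State.setVar_var, if_pos, if_neg (Ne.symm hx), hF0]
          omega
        · rw [State.setVar_var, if_neg (Ne.symm hx), hF0] at h2
          simp only [Expr.cost]
          rw [Nat.succ_mul]
          omega
    obtain ⟨t, h1, h2⟩ := key (s.var 0) 0 (by omega)
    refine ⟨_, .seq (.assign x (.lit 0) s) h1, ?_⟩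
    simp only [time, Expr.cost, Polynomial.eval_add, Polynomial.eval_mul, Polynomial.eval_X,
      Polynomial.eval_ofNat]
    omega

end Cmd

end RAM

namespace RAM

/-! ### The matching program -/

/-- The expression is nonzero if and only if the values of `e` and `f` differ. -/
def Expr.dist (e f : Expr) : Expr := .add (.sub e f) (.sub f e)

theorem Expr.eval_dist {s : State} {e f : Expr} : (dist e f).eval s ≠ 0 ↔ e.eval s ≠ f.eval s := by
  simp only [dist, eval]
  omega

/-- Position of row `i` and column `j` in a square array; the array `6` holds the offsets of the
rows. -/
def Expr.pos (i j : Expr) : Expr := .add (.get 6 i) j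

namespace Cmd

open RAM.Expr

/-- Set the variable `12` to entry number `var 8` of `rematch (wit v) v w`, where `v` and `w` are the
variables `5` and `6`. -/
def rematchEntry : Cmd :=
  ite (dist (var 8) (var 5))
    (ite (dist (var 8) (var 6))
      (ite (dist (var 8) (get 5 (pos (var 5) (var 6))))
        (assign 12 (get 5 (pos (var 5) (var 8))))
        (assign 12 (var 8)))
      (assign 12 (var 5)))
    (assign 12 (var 6))

/-- Replace the matching by the rematched witness and leave the search. -/
def augment : Cmd :=
  forn 8 (rematchEntry ;; store 2 (var 8) (var 12)) ;; assign 9 (lit 1)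

/-- Add the matching edge of `w` to the tree. -/
def growTree : Cmd :=
  assign 10 (get 2 (var 6)) ;;
  forn 8 (rematchEntry ;; store 5 (pos (var 10) (var 8)) (var 12)) ;;
  forn 8 (store 4 (pos (var 6) (var 8)) (get 4 (pos (var 5) (var 8)))) ;;
  forn 8 (store 4 (pos (var 10) (var 8)) (get 4 (pos (var 5) (var 8)))) ;;
  store 4 (pos (var 10) (var 6)) (lit 1) ;;
  store 3 (var 6) (lit 2) ;;
  store 3 (var 10) (lit 1)

/-- Set the variable `15` to entry number `var 8` of `mergeWit p q a`, where `p`, `q` and `a` are the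
variables `12`, `13` and `14`. -/
def mergeEntry : Cmd :=
  ite (dist (var 8) (var 14))
    (ite (dist (var 8) (var 12))
      (ite (dist (var 8) (var 13))
        (ite (get 4 (pos (var 8) (var 14)))
          (assign 15 (get 5 (pos (var 12) (var 8))))
          (assign 15 (get 5 (pos (var 13) (var 8)))))
        (assign 15 (var 12)))
      (assign 15 (var 13)))
    (assign 15 (var 14))

/-- Make the inner vertex `a` an outer vertex. -/
def mergeVertex : Cmd :=
  ite (get 4 (pos (var 5) (var 14)))
    (assign 12 (var 5) ;; assign 13 (var 6))
    (assign 12 (var 6) ;; assign 13 (var 5)) ;;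
  forn 8 (mergeEntry ;; store 5 (pos (var 14) (var 8)) (var 15)) ;;
  store 3 (var 14) (lit 1)

/-- Close the blossom of the edge `vw`. -/
def mergeTree : Cmd :=
  forn 14
    (ite (dist (get 3 (var 14)) (lit 2)) skip
      (ite (dist (get 4 (pos (var 5) (var 14))) (get 4 (pos (var 6) (var 14))))
        mergeVertex skip))

/-- Apply the rule for the pair `(v, w)`. -/
def searchStep : Cmd :=
  ite (var 9) skip
    (ite (get 0 (pos (var 5) (var 6)))
      (ite (dist (get 3 (var 5)) (lit 1)) skip
        (ite (get 3 (var 6))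
          (ite (dist (get 3 (var 6)) (lit 1)) skip mergeTree)
          (ite (dist (get 2 (var 6)) (var 6)) growTree augment)))
      skip)

/-- Start the search from the vertex in the variable `3`. -/
def searchInit : Cmd :=
  forn 7 (store 3 (var 7) (lit 0)) ;;
  store 3 (var 3) (lit 1) ;;
  forn 7 (forn 8 (store 4 (pos (var 7) (var 8)) (lit 0))) ;;
  forn 8 (store 5 (pos (var 3) (var 8)) (get 2 (var 8))) ;;
  assign 9 (dist (get 2 (var 3)) (var 3))

/-- Search for an augmenting path from the vertex in the variable `3`. -/
def search : Cmd := searchInit ;; forn 4 (forn 5 (forn 6 searchStep))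

/-- Compute the offsets of the rows and start with the empty matching. -/
def prepare : Cmd :=
  forn 7 (store 6 (var 7) (var 11) ;; assign 11 (add (var 11) (var 0))) ;;
  forn 7 (store 2 (var 7) (var 7))

/-- Compute a maximum matching. -/
def matching : Cmd := prepare ;; forn 3 search

/-- Write the starting times of the matched pairs. -/
def schedulePairs : Cmd :=
  forn 7 (ite (sub (get 2 (var 7)) (var 7))
    (store 1 (var 7) (var 15) ;;
     store 1 (get 2 (var 7)) (add (var 15) (var 1)) ;;
     assign 15 (add (var 15) (var 16)))
    skip)

/-- Write the starting times of the unmatched tasks. -/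
def scheduleRest : Cmd :=
  forn 7 (ite (dist (get 2 (var 7)) (var 7)) skip
    (store 1 (var 7) (var 15) ;;
     assign 15 (add (var 15) (var 17))))

/-- Write the starting times of the tasks. -/
def schedule : Cmd :=
  assign 15 (lit 0) ;;
  assign 17 (add (add (var 1) (var 1)) (add (var 2) (var 2))) ;;
  assign 16 (add (var 1) (var 17)) ;;
  schedulePairs ;; scheduleRest

/-- A loop that fills a segment of an array. -/
theorem forn_store {x k : ℕ} {p : Cmd} (s : State) (base : ℕ) (f : ℕ → ℕ)
    (hx : x ≠ 0) (hw : p.writes 0 = false)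
    (hstep : ∀ i s', i < s.var 0 → s'.var x = i →
      (∀ y, y ≠ x → p.writes y = false → s'.var y = s.var y) →
      (∀ l j, s'.arr l j = if l = k ∧ base ≤ j ∧ j < base + i then f (j - base) else s.arr l j) →
      ∀ l j, (p.run s').arr l j = if l = k ∧ j = base + i then f i else s'.arr l j) (l j : ℕ) :
    ((forn x p).run s).arr l j =
      if l = k ∧ base ≤ j ∧ j < base + s.var 0 then f (j - base) else s.arr l j := by
  obtain ⟨s', ⟨h1, -⟩, -, h3⟩ := forn_induction (x := x) (p := p) s (fun i s' =>
    (∀ l j, s'.arr l j = if l = k ∧ base ≤ j ∧ j < base + i then f (j - base) else s.arr l j) ∧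
    (∀ y, y ≠ x → p.writes y = false → s'.var y = s.var y)) ⟨by
      intro l j
      rw [if_neg (by omega)], fun _ _ _ => rfl⟩ hx hw (by
      intro i s' hi _ ⟨h1, h2⟩
      have h2' : ∀ y, y ≠ x → p.writes y = false → (s'.setVar x i).var y = s.var y := by
        intro y hy hpy
        rw [State.setVar_var, if_neg hy, h2 y hy hpy]
      refine ⟨?_, fun y hy hpy => by rw [p.run_var hpy, h2' y hy hpy]⟩
      intro l j
      rw [hstep i _ hi (by simp) h2' (by simpa using h1), State.setVar_arr, h1]
      by_cases hl : l = k
      · by_cases hj : j = base + i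
        · subst hj
          simp [hl]
        · have : (j < base + (i + 1)) ↔ j < base + i := by omega
          simp [hl, hj, this]
      · simp [hl])
  rw [h3, State.setVar_arr, h1]

end Cmd

end RAM

/-! ### Memory representation of the search; augmenting and growing the tree. -/

namespace RAM

open Cmd RAM.Expr

variable {n : ℕ}

/-- Uniqueness of the quotient by `n`: the rows of a square array occupy disjoint segments. -/
theorem row_pos {i j d : ℕ} (hj : j < n) : d * n ≤ i * n + j ∧ i * n + j < d * n + n ↔ i = d := by
  constructor
  · rintro ⟨h1, h2⟩
    have h3 : d < i + 1 := lt_of_mul_lt_mul_right (a := n)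
      (lt_of_le_of_lt h1 (by rw [Nat.succ_mul]; omega)) (Nat.zero_le n)
    have h4 : i < d + 1 := lt_of_mul_lt_mul_right (a := n)
      (lt_of_le_of_lt (Nat.le_add_right _ j) (by rw [Nat.succ_mul]; omega)) (Nat.zero_le n)
    omega
  · rintro rfl
    omega

theorem pos_inj {i j i' j' : ℕ} (hj : j < n) (hj' : j' < n) :
    i * n + j = i' * n + j' ↔ i = i' ∧ j = j' := by
  constructor
  · intro h
    have := (row_pos (d := i') hj (i := i)).1 (by omega)
    subst this
    omega
  · rintro ⟨rfl, rfl⟩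
    rfl

/-- The part of the memory that does not change after the preparation. -/
structure Env (G : SimpleGraph (Fin n)) (s : State) : Prop where
  size : s.var 0 = n
  adj : ∀ i j : Fin n, s.arr 0 (i * n + j) ≠ 0 ↔ G.Adj i j
  offset : ∀ i : Fin n, s.arr 6 i = i * n

/-- The array `2` holds the map `M`. -/
def Holds (M : Fin n → Fin n) (s : State) : Prop := ∀ i : Fin n, s.arr 2 i = M i

open Classical in
/-- The arrays `3`, `4`, `5` hold the stage `S` of the search. -/
structure Rep (S : Search (Fin n)) (s : State) : Prop where
  label : ∀ i : Fin n, s.arr 3 i = if S.outer i then 1 else if S.inner i then 2 else 0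
  anc : ∀ i j : Fin n, s.arr 4 (i * n + j) = if S.anc i j then 1 else 0
  wit : ∀ v : Fin n, S.outer v → ∀ x : Fin n, s.arr 5 (v * n + x) = S.wit v x

variable {G : SimpleGraph (Fin n)} {M : Fin n → Fin n} {S : Search (Fin n)} {s : State} {r : Fin n}

theorem Env.congr {s' : State} (h : Env G s) (h0 : s'.var 0 = s.var 0) (ha : s'.arr 0 = s.arr 0)
    (hb : s'.arr 6 = s.arr 6) : Env G s' :=
  ⟨h0.trans h.size, by rw [ha]; exact h.adj, by rw [hb]; exact h.offset⟩

theorem Env.run (h : Env G s) (p : Cmd) (h0 : p.writes 0 = false) (ha : p.stores 0 = false)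
    (hb : p.stores 6 = false) : Env G (p.run s) :=
  h.congr (p.run_var h0 s) (p.run_arr ha s) (p.run_arr hb s)

theorem Holds.congr {s' : State} (h : Holds M s) (ha : s'.arr 2 = s.arr 2) : Holds M s' := by
  unfold Holds
  rw [ha]
  exact h

theorem Rep.congr {s' : State} (h : Rep S s) (h3 : s'.arr 3 = s.arr 3) (h4 : s'.arr 4 = s.arr 4)
    (h5 : s'.arr 5 = s.arr 5) : Rep S s' :=
  ⟨by rw [h3]; exact h.label, by rw [h4]; exact h.anc, by rw [h5]; exact h.wit⟩

/-- A loop that fills a row of a square array. -/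
theorem forn_store_row {x k : ℕ} {p : Cmd} (hs : s.var 0 = n) (d : Fin n)
    (f : Fin n → ℕ) (hx : x ≠ 0) (hw : p.writes 0 = false)
    (hstep : ∀ (i : Fin n) (s' : State), s'.var x = (i : ℕ) →
      (∀ y, y ≠ x → p.writes y = false → s'.var y = s.var y) →
      (∀ l, l ≠ k → s'.arr l = s.arr l) →
      (∀ i j : Fin n, i ≠ d → s'.arr k (i * n + j) = s.arr k (i * n + j)) →
      ∀ l j, (p.run s').arr l j = if l = k ∧ j = d * n + i then f i else s'.arr l j)
    (i j : Fin n) :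
    ((forn x p).run s).arr k (i * n + j) = if i = d then f j else s.arr k (i * n + j) := by
  have key := forn_store (x := x) (k := k) (p := p) s (d * n)
    (fun i => if h : i < n then f ⟨i, h⟩ else 0) hx hw (by
      intro i s' hi hvx hvar harr
      rw [hs] at hi
      have := hstep ⟨i, hi⟩ s' hvx hvar (by
        intro l hl
        ext j
        rw [harr, if_neg (by tauto)]) (by
        intro i' j hi'
        rw [harr, if_neg]
        rintro ⟨-, h1, h2⟩
        exact hi' (Fin.ext ((row_pos j.2).1 ⟨h1, by omega⟩)))
      simpa [hi] using this)
  rw [key, hs]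
  by_cases h : i = d
  · subst h
    rw [if_pos ⟨rfl, by omega, by omega⟩, if_pos rfl, dif_pos (by omega)]
    congr 1
    ext
    simp
  · rw [if_neg, if_neg h]
    rintro ⟨-, h1, h2⟩
    exact h (Fin.ext ((row_pos j.2).1 ⟨h1, h2⟩))

/-- A loop that fills the first entries of an array. -/
theorem forn_store_vec {x k : ℕ} {p : Cmd} (hs : s.var 0 = n)
    (f : Fin n → ℕ) (hx : x ≠ 0) (hw : p.writes 0 = false)
    (hstep : ∀ (i : Fin n) (s' : State), s'.var x = (i : ℕ) →
      (∀ y, y ≠ x → p.writes y = false → s'.var y = s.var y) →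
      (∀ l, l ≠ k → s'.arr l = s.arr l) →
      ∀ l j, (p.run s').arr l j = if l = k ∧ j = i then f i else s'.arr l j)
    (j : Fin n) :
    ((forn x p).run s).arr k j = f j := by
  have key := forn_store (x := x) (k := k) (p := p) s 0
    (fun i => if h : i < n then f ⟨i, h⟩ else 0) hx hw (by
      intro i s' hi hvx hvar harr
      rw [hs] at hi
      have := hstep ⟨i, hi⟩ s' hvx hvar (by
        intro l hl
        ext j
        rw [harr, if_neg (by tauto)])
      simpa [hi] using this)
  rw [key, hs, if_pos ⟨rfl, by omega, by omega⟩, dif_pos (by omega)]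
  rfl

theorem rematchEntry_run {f : Fin n → Fin n} {v w j : Fin n} (h5 : s.var 5 = v) (h6 : s.var 6 = w)
    (h8 : s.var 8 = j) (hoff : s.arr 6 v = v * n) (hf : ∀ x : Fin n, s.arr 5 (v * n + x) = f x) :
    rematchEntry.run s = s.setVar 12 (rematch f v w j : Fin n) := by
  simp only [rematchEntry, Cmd.run, eval_dist, Expr.eval, Expr.pos, h5, h6, h8, hoff, hf, rematch,
    ne_eq, Fin.val_inj]
  split_ifs <;> simp_all

theorem augment_run {v w : Fin n} {f : Fin n → Fin n} (henv : Env G s) (h5 : s.var 5 = v)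
    (h6 : s.var 6 = w) (hf : ∀ x : Fin n, s.arr 5 (v * n + x) = f x) :
    Holds (rematch f v w) (augment.run s) := by
  intro i
  change ((forn 8 _).run s).arr 2 i = _
  refine forn_store_vec (f := fun i => ((rematch f v w i : Fin n) : ℕ)) henv.size (by decide) rfl ?_ i
  intro i s' hi hvar harr l j
  have h5' : s'.var 5 = v := (hvar 5 (by decide) rfl).trans h5
  have h6' : s'.var 6 = w := (hvar 6 (by decide) rfl).trans h6
  rw [Cmd.run, rematchEntry_run (f := f) h5' h6' hi (by rw [harr 6 (by decide), henv.offset])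
    (by rw [harr 5 (by decide)]; exact hf)]
  simp [Cmd.run, Expr.eval, hi]

theorem growTree_run {v w : Fin n} (henv : Env G s) (hM : Holds M s) (hrep : Rep S s)
    (hinv : S.Inv G M r) (h5 : s.var 5 = v) (h6 : s.var 6 = w) (hv : S.outer v)
    (ho : ¬ S.outer w) (hi : ¬ S.inner w) (hw : M w ≠ w) :
    Rep (S.grow M v w) (growTree.run s) := by
  classical
  have hMM := hinv.mate.invol
  have hxo : ¬ S.outer (M w) := fun hc => by
    have := hinv.mate_reached _ (.inl hc); rw [hMM] at this; tauto
  have hvw : v ≠ w := fun e => ho (e ▸ hv)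
  -- The loops read row `v` and write rows `w` and `M w`. As `v` is neither of these, the data read
  -- are the old ones throughout.
  have hvx : v ≠ M w := fun e => hxo (e ▸ hv)
  obtain ⟨s₁, hs₁⟩ : ∃ s₁, s₁ = (Cmd.assign 10 (get 2 (var 6))).run s := ⟨_, rfl⟩
  have e₁ : Env G s₁ := hs₁ ▸ henv.run _ rfl rfl rfl
  have v₁ : s₁.var 5 = v ∧ s₁.var 6 = w ∧ s₁.var 10 = M w := by
    simp [hs₁, Cmd.run, Expr.eval, h5, h6, hM w]
  have a₁ : s₁.arr = s.arr := by rw [hs₁]; rfl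
  obtain ⟨s₂, hs₂⟩ : ∃ s₂, s₂ = (forn 8 (rematchEntry ;;
    store 5 (pos (var 10) (var 8)) (var 12))).run s₁ := ⟨_, rfl⟩
  have e₂ : Env G s₂ := hs₂ ▸ e₁.run _ rfl rfl rfl
  have v₂ : s₂.var 5 = v ∧ s₂.var 6 = w ∧ s₂.var 10 = M w := by
    rw [hs₂, Cmd.run_var _ rfl, Cmd.run_var _ rfl, Cmd.run_var _ rfl]
    exact v₁
  have w₂ : ∀ i j : Fin n, s₂.arr 5 (i * n + j) =
      if i = M w then ((rematch (S.wit v) v w j : Fin n) : ℕ) else s.arr 5 (i * n + j) := by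
    rw [hs₂, ← a₁]
    refine forn_store_row (f := fun i => ((rematch (S.wit v) v w i : Fin n) : ℕ)) e₁.size (M w)
      (by decide) rfl ?_
    intro i s' hi hvar harr hrow l j
    have h5' : s'.var 5 = v := (hvar 5 (by decide) rfl).trans v₁.1
    have h6' : s'.var 6 = w := (hvar 6 (by decide) rfl).trans v₁.2.1
    have h10 : s'.var 10 = M w := (hvar 10 (by decide) rfl).trans v₁.2.2
    have hoff : ∀ i : Fin n, s'.arr 6 i = i * n := by rw [harr 6 (by decide)]; exact e₁.offset
    rw [Cmd.run, rematchEntry_run (f := S.wit v) h5' h6' hi (hoff v)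
      (fun x => by rw [hrow _ _ hvx, a₁, hrep.wit v hv])]
    simp [Cmd.run, Expr.eval, Expr.pos, hi, h10, hoff]
  have a₂ : ∀ l, l ≠ 5 → s₂.arr l = s.arr l := by
    intro l hl
    rw [hs₂, Cmd.run_arr _ (by simp [Cmd.stores, rematchEntry, hl.symm]), a₁]
  obtain ⟨s₃, hs₃⟩ : ∃ s₃, s₃ = (forn 8 (store 4 (pos (var 6) (var 8))
    (get 4 (pos (var 5) (var 8))))).run s₂ := ⟨_, rfl⟩
  have e₃ : Env G s₃ := hs₃ ▸ e₂.run _ rfl rfl rfl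
  have v₃ : s₃.var 5 = v ∧ s₃.var 6 = w ∧ s₃.var 10 = M w := by
    rw [hs₃, Cmd.run_var _ rfl, Cmd.run_var _ rfl, Cmd.run_var _ rfl]
    exact v₂
  have w₃ : ∀ i j : Fin n, s₃.arr 4 (i * n + j) =
      if i = w then s.arr 4 (v * n + j) else s.arr 4 (i * n + j) := by
    rw [hs₃, ← a₂ 4 (by decide)]
    refine forn_store_row (f := fun j => s₂.arr 4 (v * n + j)) e₂.size w (by decide) rfl ?_
    intro i s' hi hvar harr hrow l j
    have h5' : s'.var 5 = v := (hvar 5 (by decide) rfl).trans v₂.1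
    have h6' : s'.var 6 = w := (hvar 6 (by decide) rfl).trans v₂.2.1
    have hoff : ∀ i : Fin n, s'.arr 6 i = i * n := by rw [harr 6 (by decide)]; exact e₂.offset
    simp [Cmd.run, Expr.eval, Expr.pos, hi, h5', h6', hoff, hrow _ _ hvw]
  have a₃ : ∀ l, l ≠ 4 → s₃.arr l = s₂.arr l := by
    intro l hl
    rw [hs₃, Cmd.run_arr _ (by simp [Cmd.stores, hl.symm])]
  obtain ⟨s₄, hs₄⟩ : ∃ s₄, s₄ = (forn 8 (store 4 (pos (var 10) (var 8))
    (get 4 (pos (var 5) (var 8))))).run s₃ := ⟨_, rfl⟩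
  have e₄ : Env G s₄ := hs₄ ▸ e₃.run _ rfl rfl rfl
  have v₄ : s₄.var 6 = w ∧ s₄.var 10 = M w := by
    rw [hs₄, Cmd.run_var _ rfl, Cmd.run_var _ rfl]
    exact v₃.2
  have w₄ : ∀ i j : Fin n, s₄.arr 4 (i * n + j) =
      if i = M w then s.arr 4 (v * n + j) else s₃.arr 4 (i * n + j) := by
    rw [hs₄]
    refine forn_store_row (f := fun j => s.arr 4 (v * n + j)) e₃.size (M w) (by decide) rfl ?_
    intro i s' hi hvar harr hrow l j
    have h5' : s'.var 5 = v := (hvar 5 (by decide) rfl).trans v₃.1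
    have h10 : s'.var 10 = M w := (hvar 10 (by decide) rfl).trans v₃.2.2
    have hoff : ∀ i : Fin n, s'.arr 6 i = i * n := by rw [harr 6 (by decide)]; exact e₃.offset
    simp [Cmd.run, Expr.eval, Expr.pos, hi, h5', h10, hoff, hrow _ _ hvx, w₃, hvw]
  have a₄ : ∀ l, l ≠ 4 → s₄.arr l = s₂.arr l := by
    intro l hl
    rw [hs₄, Cmd.run_arr _ (by simp [Cmd.stores, hl.symm]), a₃ l hl]
  have hfin : growTree.run s = ((s₄.setArr 4 ((M w : ℕ) * n + w) 1).setArr 3 w 2).setArr 3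
      (M w) 1 := by
    change (store 3 (var 10) (lit 1)).run ((store 3 (var 6) (lit 2)).run
      ((store 4 (pos (var 10) (var 6)) (lit 1)).run ((forn 8 _).run ((forn 8 _).run
        ((forn 8 _).run ((Cmd.assign 10 _).run s)))))) = _
    rw [← hs₁, ← hs₂, ← hs₃, ← hs₄]
    simp [Cmd.run, Expr.eval, Expr.pos, v₄, e₄.offset]
  rw [hfin]
  constructor
  · intro i
    simp only [State.setArr_arr, true_and, Fin.val_inj, a₄ 3 (by decide), a₂ 3 (by decide),
      hrep.label, Search.grow]
    by_cases h1 : i = M w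
    · simp [h1]
    · by_cases h2 : i = w
      · subst h2
        simp [ho, Ne.symm hw]
      · simp [h1, h2]
  · intro i j
    simp only [State.setArr_arr, true_and, pos_inj j.2 w.2, Fin.val_inj, w₄, w₃, hrep.anc,
      Search.grow]
    by_cases h1 : i = M w
    · by_cases h2 : j = w <;> simp [h1, h2, hw]
    · by_cases h2 : i = w <;> simp [h1, h2, Ne.symm hw]
  · intro u hu x
    simp only [State.setArr_arr, a₄ 5 (by decide), w₂, Search.grow]
    by_cases h1 : u = M w
    · simp only [h1, if_true, Nat.reduceEqDiff, false_and, if_false]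
      congr!
    · simp [h1, hrep.wit u (hu.resolve_right h1)]

end RAM

/-! ### Closing blossoms and a single search step. -/

namespace RAM

open Cmd RAM.Expr

variable {n : ℕ} {G : SimpleGraph (Fin n)} {M : Fin n → Fin n} {S : Search (Fin n)} {s : State}
  {r : Fin n}

theorem mergeEntry_run {p q a j : Fin n} (h12 : s.var 12 = p) (h13 : s.var 13 = q)
    (h14 : s.var 14 = a) (h8 : s.var 8 = j) (hoff : ∀ i : Fin n, s.arr 6 i = i * n)
    (hanc : s.arr 4 (j * n + a) ≠ 0 ↔ S.anc j a)
    (hp : ∀ x : Fin n, s.arr 5 (p * n + x) = S.wit p x)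
    (hq : ∀ x : Fin n, s.arr 5 (q * n + x) = S.wit q x) :
    mergeEntry.run s = s.setVar 15 (S.mergeWit p q a j : Fin n) := by
  simp only [mergeEntry, Cmd.run, eval_dist, Expr.eval, Expr.pos, h12, h13, h14, h8, hoff, hp, hq,
    hanc, Search.mergeWit, ne_eq, Fin.val_inj]
  split_ifs <;> simp_all

theorem mergeVertex_run {v w a : Fin n} (henv : Env G s) (h5 : s.var 5 = v) (h6 : s.var 6 = w)
    (h14 : s.var 14 = a) (hav : a ≠ v) (haw : a ≠ w)
    (hanc : ∀ i j : Fin n, s.arr 4 (i * n + j) ≠ 0 ↔ S.anc i j)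
    (hv : ∀ x : Fin n, s.arr 5 (v * n + x) = S.wit v x)
    (hw : ∀ x : Fin n, s.arr 5 (w * n + x) = S.wit w x) (ho : ¬ S.outer a) :
    (∀ i : Fin n, (mergeVertex.run s).arr 3 i = if i = a then 1 else s.arr 3 i) ∧
    (∀ i j : Fin n, (mergeVertex.run s).arr 5 (i * n + j) =
      if i = a then (((S.merge v w).wit a j : Fin n) : ℕ) else s.arr 5 (i * n + j)) := by
  obtain ⟨p, q, hpq, hpq', h12, h13, harr⟩ : ∃ p q : Fin n,
      (S.merge v w).wit a = S.mergeWit p q a ∧ (p = v ∧ q = w ∨ p = w ∧ q = v) ∧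
      ((ite (get 4 (pos (var 5) (var 14))) (assign 12 (var 5) ;; assign 13 (var 6))
        (assign 12 (var 6) ;; assign 13 (var 5))).run s).var 12 = p ∧
      ((ite (get 4 (pos (var 5) (var 14))) (assign 12 (var 5) ;; assign 13 (var 6))
        (assign 12 (var 6) ;; assign 13 (var 5))).run s).var 13 = q ∧
      ((ite (get 4 (pos (var 5) (var 14))) (assign 12 (var 5) ;; assign 13 (var 6))
        (assign 12 (var 6) ;; assign 13 (var 5))).run s).arr = s.arr := by
    by_cases h : S.anc v a
    · refine ⟨v, w, by simp [Search.merge, ho, h], by simp, ?_⟩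
      have := (hanc v a).2 h
      simp [Cmd.run, Expr.eval, Expr.pos, h5, h6, h14, henv.offset, this]
    · refine ⟨w, v, by simp [Search.merge, ho, h], by simp, ?_⟩
      have := not_not.1 (mt (hanc v a).1 h)
      simp [Cmd.run, Expr.eval, Expr.pos, h5, h6, h14, henv.offset, this]
  have hap : a ≠ p := by grind
  have haq : a ≠ q := by grind
  have hp' : ∀ x : Fin n, s.arr 5 (p * n + x) = S.wit p x := by grind
  have hq' : ∀ x : Fin n, s.arr 5 (q * n + x) = S.wit q x := by grind
  obtain ⟨s₁, hs₁⟩ : ∃ s₁, s₁ = (ite (get 4 (pos (var 5) (var 14)))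
    (assign 12 (var 5) ;; assign 13 (var 6))
    (assign 12 (var 6) ;; assign 13 (var 5))).run s := ⟨_, rfl⟩
  have e₁ : Env G s₁ := hs₁ ▸ henv.run _ rfl rfl rfl
  have u₁ : s₁.var 14 = a := by
    rw [hs₁, Cmd.run_var _ rfl, h14]
  rw [← hs₁] at h12 h13 harr
  obtain ⟨s₂, hs₂⟩ : ∃ s₂, s₂ = (forn 8 (mergeEntry ;;
    store 5 (pos (var 14) (var 8)) (var 15))).run s₁ := ⟨_, rfl⟩
  have u₂ : s₂.var 14 = a := by
    rw [hs₂, Cmd.run_var _ rfl, u₁]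
  have w₂ : ∀ i j : Fin n, s₂.arr 5 (i * n + j) =
      if i = a then ((S.mergeWit p q a j : Fin n) : ℕ) else s.arr 5 (i * n + j) := by
    rw [hs₂, ← harr]
    refine forn_store_row (f := fun i => ((S.mergeWit p q a i : Fin n) : ℕ)) e₁.size a
      (by decide) rfl ?_
    intro i s' hi hvar harr' hrow l j
    have g12 : s'.var 12 = p := (hvar 12 (by decide) rfl).trans h12
    have g13 : s'.var 13 = q := (hvar 13 (by decide) rfl).trans h13
    have g14 : s'.var 14 = a := (hvar 14 (by decide) rfl).trans u₁
    have hoff : ∀ i : Fin n, s'.arr 6 i = i * n := by rw [harr' 6 (by decide)]; exact e₁.offset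
    rw [Cmd.run, mergeEntry_run (S := S) g12 g13 g14 hi hoff
      (by rw [harr' 4 (by decide), harr]; exact hanc i a)
      (fun x => by rw [hrow _ _ hap.symm, harr, hp'])
      (fun x => by rw [hrow _ _ haq.symm, harr, hq'])]
    simp [Cmd.run, Expr.eval, Expr.pos, hi, g14, hoff]
  have hfin : mergeVertex.run s = s₂.setArr 3 a 1 := by
    change (store 3 (var 14) (lit 1)).run ((forn 8 _).run (Cmd.run _ s)) = _
    rw [← hs₁, ← hs₂]
    simp [Cmd.run, Expr.eval, u₂]
  have a₂ : s₂.arr 3 = s.arr 3 := by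
    rw [hs₂, Cmd.run_arr _ (by rfl), harr]
  rw [hfin, hpq]
  constructor
  · intro i
    simp [a₂, Fin.val_inj]
  · intro i j
    simp [w₂]

theorem mergeTree_run {v w : Fin n} (henv : Env G s) (hrep : Rep S s)
    (hinv : S.Inv G M r) (h5 : s.var 5 = v) (h6 : s.var 6 = w) (hv : S.outer v) (hw : S.outer w) :
    Rep (S.merge v w) (mergeTree.run s) := by
  classical
  have hdis := hinv.disjoint
  obtain ⟨s', ⟨h1, h2, h3, h4, h5', h6'⟩, -, hrun⟩ := forn_induction (x := 14)
    (p := ite (dist (get 3 (var 14)) (lit 2)) skip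
      (ite (dist (get 4 (pos (var 5) (var 14))) (get 4 (pos (var 6) (var 14))))
        mergeVertex skip)) s
    -- After `m` iterations the labels below `m` are the new ones. The old outer vertices keep their
    -- witness rows, in particular `v` and `w`, and the ancestor array never changes. So every
    -- gluing uses the data from before the loop.
    (fun m s' => Env G s' ∧
      (∀ i : Fin n, s'.arr 3 i = if (i : ℕ) < m then
        (if (S.merge v w).outer i then 1 else if (S.merge v w).inner i then 2 else 0)
        else s.arr 3 i) ∧ s'.arr 4 = s.arr 4 ∧
      (∀ a : Fin n, S.outer a ∨ ((S.merge v w).outer a ∧ (a : ℕ) < m) →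
        ∀ x : Fin n, s'.arr 5 (a * n + x) = (S.merge v w).wit a x) ∧
      s'.var 5 = v ∧ s'.var 6 = w)
    ⟨henv, by simp, rfl, by
      intro a ha x
      have ha : S.outer a := by simpa using ha
      rw [hrep.wit a ha]
      simp [Search.merge, ha], h5, h6⟩ (by decide) rfl (by
    intro i s' hi _ ⟨i1, i2, i3, i4, i5, i6⟩
    rw [henv.size] at hi
    obtain ⟨a, rfl⟩ : ∃ a : Fin n, (a : ℕ) = i := ⟨⟨i, hi⟩, rfl⟩
    obtain ⟨s'', hs''⟩ : ∃ s'', s'' = s'.setVar 14 a := ⟨_, rfl⟩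
    have ha'' : s''.arr = s'.arr := by rw [hs'']; rfl
    have v5 : s''.var 5 = v := by simp [hs'', i5]
    have v6 : s''.var 6 = w := by simp [hs'', i6]
    have v14 : s''.var 14 = a := by simp [hs'']
    have henv'' : Env G s'' := i1.congr (by simp [hs'']) (by rw [ha'']) (by rw [ha''])
    rw [← hs'']
    clear hs''
    have hlab : s'.arr 3 a = if S.outer a then 1 else if S.inner a then 2 else 0 := by
      rw [i2, if_neg (lt_irrefl _), hrep.label]
    have hsucc : ∀ i : Fin n, (i : ℕ) < a + 1 ↔ (i : ℕ) < a ∨ i = a := by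
      intro i
      rw [← Fin.val_inj]
      omega
    have hanc : ∀ i j : Fin n, s''.arr 4 (i * n + j) ≠ 0 ↔ S.anc i j := by
      intro i j
      rw [ha'', i3, hrep.anc]
      simp
    have hmi : ∀ x, (S.merge v w).inner x ↔ S.inner x ∧ (S.anc v x ↔ S.anc w x) := fun _ => Iff.rfl
    have hmo : ∀ x, (S.merge v w).outer x ↔
      S.outer x ∨ (S.inner x ∧ ¬ (S.anc v x ↔ S.anc w x)) := fun _ => Iff.rfl
    by_cases hcase : S.inner a ∧ ¬ (S.anc v a ↔ S.anc w a)
    · obtain ⟨hia, hne⟩ := hcase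
      have hoa : ¬ S.outer a := fun hc => hdis a hc hia
      have hav : a ≠ v := fun e => hoa (e ▸ hv)
      have haw : a ≠ w := fun e => hoa (e ▸ hw)
      have hrun : (ite (dist (get 3 (var 14)) (lit 2)) skip
          (ite (dist (get 4 (pos (var 5) (var 14))) (get 4 (pos (var 6) (var 14))))
            mergeVertex skip)).run s'' = mergeVertex.run s'' := by
        rw [Cmd.run, if_neg, Cmd.run, if_pos]
        · rw [eval_dist]
          simp only [Expr.eval, Expr.pos, v5, v6, v14, henv''.offset, ha'', i3, hrep.anc]
          split_ifs <;> simp_all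
        · rw [eval_dist]
          simp [Expr.eval, v14, ha'', hlab, hoa, hia]
      rw [hrun]
      have hwv : ∀ u : Fin n, S.outer u → ∀ x : Fin n, s''.arr 5 (u * n + x) = S.wit u x := by
        intro u hu x
        rw [ha'', i4 u (.inl hu)]
        simp [Search.merge, hu]
      obtain ⟨k1, k2⟩ := mergeVertex_run (S := S) henv'' v5 v6 v14 hav haw hanc (hwv v hv)
        (hwv w hw) hoa
      refine ⟨henv''.run _ rfl rfl rfl, ?_, ?_, ?_, ?_, ?_⟩
      · intro i
        rw [k1, ha'', i2]
        by_cases hia' : i = a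
        · subst hia'
          simp [hmo, hia, hne]
        · simp [hsucc, hia']
      · rw [Cmd.run_arr _ rfl, ha'', i3]
      · intro i hi x
        rw [k2, ha'']
        by_cases hia' : i = a
        · subst hia'
          simp
        · rw [if_neg hia', i4 i]
          simpa [hsucc, hia'] using hi
      · rw [Cmd.run_var _ rfl, v5]
      · rw [Cmd.run_var _ rfl, v6]
    · have hrun : (ite (dist (get 3 (var 14)) (lit 2)) skip
          (ite (dist (get 4 (pos (var 5) (var 14))) (get 4 (pos (var 6) (var 14))))
            mergeVertex skip)).run s'' = s'' := by
        rw [Cmd.run]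
        split_ifs with h
        · rfl
        · rw [eval_dist, not_not] at h
          have hia : S.inner a := by
            simp only [Expr.eval, v14, ha'', hlab] at h
            split_ifs at h <;> simp_all
          rw [Cmd.run, if_neg, Cmd.run]
          rw [eval_dist, not_not]
          have hiff : S.anc v a ↔ S.anc w a := by tauto
          simp only [Expr.eval, Expr.pos, v5, v6, v14, henv''.offset, ha'', i3, hrep.anc, hiff]
      rw [hrun]
      refine ⟨henv'', ?_, by rw [ha'', i3], ?_, v5, v6⟩
      · intro i
        rw [ha'', i2]
        by_cases hia' : i = a
        · subst hia'
          rw [if_neg (lt_irrefl _), if_pos (by omega), hrep.label]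
          have h1 : (S.merge v w).outer i ↔ S.outer i := by rw [hmo]; tauto
          by_cases h2 : S.inner i
          · have h3 : (S.merge v w).inner i ↔ S.inner i := by rw [hmi]; tauto
            simp only [h1, h3]
          · have h3 : (S.merge v w).inner i ↔ S.inner i := by rw [hmi]; tauto
            simp only [h1, h3]
        · simp [hsucc, hia']
      · intro i hio x
        rw [ha'', i4 i]
        rcases hio with hio | ⟨hio, hlt⟩
        · exact .inl hio
        · rcases (hsucc i).1 hlt with hlt | rfl
          · exact .inr ⟨hio, hlt⟩
          · exact .inl (((hmo _).1 hio).resolve_right hcase))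
  change Rep _ ((forn 14 _).run s)
  rw [hrun]
  refine Rep.congr (s := s') ⟨?_, ?_, ?_⟩ rfl rfl rfl
  · intro i
    rw [h2, henv.size, if_pos i.2]
  · intro i j
    rw [h3, hrep.anc]
    rfl
  · intro u hu
    refine h4 u (.inr ⟨hu, ?_⟩)
    rw [henv.size]
    exact u.2

/-- The search has not left its loop yet: the memory holds a stage of the search. -/
structure Searching (G : SimpleGraph (Fin n)) (M : Fin n → Fin n) (r : Fin n)
    (S : Search (Fin n)) (s : State) : Prop where
  env : Env G s
  holds : Holds M s
  rep : Rep S s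
  inv : S.Inv G M r
  active : s.var 9 = 0

/-- The search has found a matching that also covers the root. -/
structure Found (G : SimpleGraph (Fin n)) (M : Fin n → Fin n) (r : Fin n) (s : State) : Prop where
  env : Env G s
  found : ∃ M', Holds M' s ∧ IsMate G M' ∧ (∀ x, M x ≠ x → M' x ≠ x) ∧ M' r ≠ r
  inactive : s.var 9 ≠ 0

theorem Searching.congr {s' : State} (h : Searching G M r S s) (h0 : s'.var 0 = s.var 0)
    (h9 : s'.var 9 = s.var 9) (ha : s'.arr = s.arr) : Searching G M r S s' :=
  ⟨h.env.congr h0 (by rw [ha]) (by rw [ha]), h.holds.congr (by rw [ha]),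
    h.rep.congr (by rw [ha]) (by rw [ha]) (by rw [ha]), h.inv, h9.trans h.active⟩

theorem Found.congr {s' : State} (h : Found G M r s) (h0 : s'.var 0 = s.var 0)
    (h9 : s'.var 9 = s.var 9) (ha : s'.arr = s.arr) : Found G M r s' :=
  ⟨h.env.congr h0 (by rw [ha]) (by rw [ha]), by
    obtain ⟨M', h1, h2⟩ := h.found
    exact ⟨M', h1.congr (by rw [ha]), h2⟩, by rw [h9]; exact h.inactive⟩

theorem Found.searchStep (h : Found G M r s) : searchStep.run s = s := by
  rw [RAM.Cmd.searchStep, Cmd.run, if_pos (by exact h.inactive), Cmd.run]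

open Classical in
/-- The number of outer vertices. -/
noncomputable def outerCard (S : Search (Fin n)) : ℕ := (Finset.univ.filter S.outer).card

theorem outerCard_lt {S S' : Search (Fin n)} (h : ∀ x, S.outer x → S'.outer x) {y : Fin n}
    (hy : S'.outer y) (hy' : ¬ S.outer y) : outerCard S < outerCard S' := by
  classical
  refine Finset.card_lt_card ((Finset.ssubset_iff_of_subset fun x hx => ?_).2 ⟨y, ?_, ?_⟩)
  · simpa using h x (by simpa using hx)
  · simpa using hy
  · simpa using hy'

/-- Every rule that keeps the search running adds an outer vertex, namely `M w` or an inner vertex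
of the blossom. This makes the number of outer vertices a measure of progress. -/
theorem searchStep_run {v w : Fin n} (h : Searching G M r S s) (h5 : s.var 5 = v)
    (h6 : s.var 6 = w) :
    Found G M r (searchStep.run s) ∨ ∃ S', Searching G M r S' (searchStep.run s) ∧
      (S.ClosedAt G v w → S' = S) ∧ (¬ S.ClosedAt G v w → outerCard S < outerCard S') := by
  classical
  obtain ⟨henv, hM, hrep, hinv, h9⟩ := h
  have hlab : ∀ i : Fin n, (s.arr 3 i = 1 ↔ S.outer i) ∧ (s.arr 3 i ≠ 0 ↔ S.outer i ∨ S.inner i) := by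
    intro i
    rw [hrep.label]
    split_ifs <;> simp_all
  have hstay : searchStep.run s = s → S.ClosedAt G v w → Found G M r (searchStep.run s) ∨
      ∃ S', Searching G M r S' (searchStep.run s) ∧
      (S.ClosedAt G v w → S' = S) ∧ (¬ S.ClosedAt G v w → outerCard S < outerCard S') := by
    intro h hc
    rw [h]
    exact .inr ⟨S, ⟨henv, hM, hrep, hinv, h9⟩, fun _ => rfl, fun h => absurd hc h⟩
  have hun : searchStep.run s = if G.Adj v w then (if S.outer v then
      (if S.outer w ∨ S.inner w then (if S.outer w then mergeTree.run s else s)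
        else (if M w ≠ w then growTree.run s else augment.run s)) else s) else s := by
    simp only [searchStep, Cmd.run, eval_dist, Expr.eval, Expr.pos, h5, h6, h9, henv.offset,
      henv.adj, (hlab _).1, (hlab _).2, hM w, ne_eq, not_true, if_false, Fin.val_inj, ite_not]
  by_cases hadj : G.Adj v w
  swap
  · exact hstay (by rw [hun, if_neg hadj]) fun _ h => absurd h hadj
  by_cases hv : S.outer v
  swap
  · exact hstay (by rw [hun, if_pos hadj, if_neg hv]) fun h => absurd h hv
  rw [if_pos hadj, if_pos hv] at hun
  by_cases hw : S.outer w
  · rw [if_pos (.inl hw), if_pos hw] at hun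
    rw [hun]
    have hrep' := mergeTree_run henv hrep hinv h5 h6 hv hw
    have h9' : (mergeTree.run s).var 9 = 0 := by rw [Cmd.run_var _ rfl, h9]
    have hM' : Holds M (mergeTree.run s) := hM.congr (Cmd.run_arr _ rfl _)
    have henv' : Env G (mergeTree.run s) := henv.run _ rfl rfl rfl
    -- The program enters `mergeTree` at every edge between outer vertices. If there is nothing to
    -- merge, the memory afterwards still represents the old stage `S`.
    by_cases hc : S.ClosedAt G v w
    · refine .inr ⟨S, ⟨henv', hM', ?_, hinv, h9'⟩, fun _ => rfl, fun h => absurd hc h⟩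
      have hc := ((hc hv hadj).resolve_left (hinv.disjoint w hw)).2
      have h1 : ∀ x, (S.merge v w).outer x ↔ S.outer x := by
        intro x
        have := hc x
        simp only [Search.merge]
        tauto
      have h2 : ∀ x, (S.merge v w).inner x ↔ S.inner x := by
        intro x
        have := hc x
        simp only [Search.merge]
        tauto
      refine ⟨fun i => ?_, hrep'.anc, fun u hu x => ?_⟩
      · rw [hrep'.label]
        simp only [h1, h2]
      · rw [hrep'.wit u ((h1 u).2 hu)]
        simp [Search.merge, hu]
    · refine .inr ⟨S.merge v w, ⟨henv', hM', hrep', hinv.merge hv hw hadj, h9'⟩,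
        fun h => absurd h hc, fun _ => ?_⟩
      obtain ⟨a, ha, hne⟩ : ∃ a, S.inner a ∧ ¬ (S.anc v a ↔ S.anc w a) := by
        by_contra! hcon
        exact hc fun _ _ => .inr ⟨hw, fun a ha => hcon a ha⟩
      exact outerCard_lt (fun x hx => .inl hx) (.inr ⟨ha, hne⟩)
        fun h => hinv.disjoint a h ha
  rw [if_neg hw] at hun
  by_cases hwi : S.inner w
  · exact hstay (by rw [hun, if_pos (.inr hwi)]) fun _ _ => .inl hwi
  rw [if_neg (by tauto)] at hun
  have hncl : ¬ S.ClosedAt G v w := fun hc => by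
    have := hc hv hadj
    tauto
  by_cases hMw : M w = w
  · rw [if_neg (not_not.2 hMw)] at hun
    rw [hun]
    have hvv : S.wit v v = v := (hinv.wit_fix v hv v).2 (.inl rfl)
    have hww : S.wit v w = w := (hinv.wit_eq v hv w hw hwi).trans hMw
    have hW := hinv.wit_mate v hv
    refine .inl ⟨henv.run _ rfl rfl rfl, ⟨_, augment_run henv h5 h6 (hrep.wit v hv),
      hW.rematch hvv hadj, ?_, ?_⟩, ?_⟩
    · intro x hx
      rw [Ne, hW.rematch_eq_self hadj.ne, hinv.wit_fix v hv, hww]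
      grind
    · rw [Ne, hW.rematch_eq_self hadj.ne, hinv.wit_fix v hv, hww]
      grind
    · simp [augment, Cmd.run, Expr.eval]
  · rw [if_pos hMw] at hun
    rw [hun]
    refine .inr ⟨S.grow M v w, ⟨henv.run _ rfl rfl rfl, hM.congr (Cmd.run_arr _ rfl _),
      growTree_run henv hM hrep hinv h5 h6 hv hw hwi hMw, hinv.grow hv hadj hw hwi hMw, ?_⟩,
      fun h => absurd h hncl, fun _ => outerCard_lt (fun x hx => .inl hx) (.inr rfl) ?_⟩
    · rw [Cmd.run_var _ rfl, h9]
    · intro hc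
      have := hinv.mate_reached _ (.inl hc)
      rw [hinv.mate.invol] at this
      tauto

end RAM

/-! ### Termination of the search and correctness of the matching program. -/

namespace RAM

open Cmd RAM.Expr

variable {n : ℕ} {G : SimpleGraph (Fin n)} {M : Fin n → Fin n} {S : Search (Fin n)} {s : State}
  {r : Fin n}

/-- The search has found something, or it is still in the stage `S` and no rule applies to the pairs
in `done`, or it has made progress since the stage `S`. -/
def Progress (G : SimpleGraph (Fin n)) (M : Fin n → Fin n) (r : Fin n) (S : Search (Fin n))
    (done : Fin n → Fin n → Prop) (s : State) : Prop :=
  Found G M r s ∨ ∃ S', Searching G M r S' s ∧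
    ((S' = S ∧ ∀ v w, done v w → S.ClosedAt G v w) ∨
      (outerCard S < outerCard S' ∧ ¬ ∀ v w, S.ClosedAt G v w))

theorem Progress.setVar {done : Fin n → Fin n → Prop} (h : Progress G M r S done s) {x : ℕ}
    (h0 : x ≠ 0) (h9 : x ≠ 9) (c : ℕ) : Progress G M r S done (s.setVar x c) := by
  rcases h with h | ⟨S', h, h'⟩
  · exact .inl (h.congr (by simp [h0.symm]) (by simp [h9.symm]) rfl)
  · exact .inr ⟨S', h.congr (by simp [h0.symm]) (by simp [h9.symm]) rfl, h'⟩

theorem Progress.size {done : Fin n → Fin n → Prop} (h : Progress G M r S done s) :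
    s.var 0 = n := by
  rcases h with h | ⟨S', h, h'⟩
  exacts [h.env.size, h.env.size]

theorem Progress.mono {done done' : Fin n → Fin n → Prop} (h : Progress G M r S done s)
    (hd : ∀ v w, done' v w → done v w) : Progress G M r S done' s := by
  rcases h with h | ⟨S', h, h' | h'⟩
  · exact .inl h
  · exact .inr ⟨S', h, .inl ⟨h'.1, fun v w hvw => h'.2 v w (hd v w hvw)⟩⟩
  · exact .inr ⟨S', h, .inr h'⟩

theorem Progress.searchStep {done : Fin n → Fin n → Prop} (h : Progress G M r S done s)
    {v w : Fin n} (h5 : s.var 5 = v) (h6 : s.var 6 = w) :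
    Progress G M r S (fun v' w' => done v' w' ∨ (v' = v ∧ w' = w)) (searchStep.run s) := by
  rcases h with h | ⟨S', h, h'⟩
  · rw [h.searchStep]
    exact .inl h
  · rcases searchStep_run h h5 h6 with hf | ⟨S'', hs, hc, hnc⟩
    · exact .inl hf
    · refine .inr ⟨S'', hs, ?_⟩
      -- If the pair is not closed, the step increases the outer count. When the stage was still
      -- `S`, this pair also witnesses that `S` was not closed.
      by_cases hcl : S'.ClosedAt G v w
      · rw [hc hcl]
        rcases h' with ⟨rfl, h'⟩ | h'
        · refine .inl ⟨rfl, ?_⟩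
          rintro v' w' (hd | ⟨rfl, rfl⟩)
          exacts [h' _ _ hd, hcl]
        · exact .inr h'
      · have hlt := hnc hcl
        rcases h' with ⟨rfl, h'⟩ | h'
        · exact .inr ⟨hlt, fun hall => hcl (hall v w)⟩
        · exact .inr ⟨h'.1.trans hlt, h'.2⟩

theorem searchRow_run {v : Fin n} (h : Progress G M r S (fun v' _ => (v' : ℕ) < v) s)
    (h5 : s.var 5 = v) :
    Progress G M r S (fun v' _ => (v' : ℕ) < v + 1) ((forn 6 searchStep).run s) := by
  obtain ⟨s', ⟨h1, -⟩, -, hrun⟩ := forn_induction (x := 6) (p := searchStep) s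
    (fun j s' => Progress G M r S (fun v' w' => (v' : ℕ) < v ∨ (v' = v ∧ (w' : ℕ) < j)) s' ∧
      s'.var 5 = v) ⟨h.mono fun v' w' h => by simpa using h, h5⟩ (by decide) rfl (by
    intro j s' hj hs' ⟨h1, h2⟩
    rw [h.size] at hj
    have := (h1.setVar (x := 6) (by decide) (by decide) j).searchStep (v := v) (w := ⟨j, hj⟩)
      (by simp [h2]) (by simp)
    refine ⟨this.mono fun v' w' hd => ?_, ?_⟩
    · have : w' = ⟨j, hj⟩ ↔ (w' : ℕ) = j := by rw [← Fin.val_inj]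
      rw [this]
      omega
    · rw [Cmd.run_var _ rfl]
      simp [h2])
  rw [hrun]
  refine (h1.setVar (by decide) (by decide) _).mono fun v' w' hd => ?_
  have : v' = v ↔ (v' : ℕ) = v := by rw [← Fin.val_inj]
  have := w'.2
  rw [h.size]
  omega

theorem searchRound_run (h : Searching G M r S s) :
    Found G M r ((forn 5 (forn 6 searchStep)).run s) ∨ ∃ S',
      Searching G M r S' ((forn 5 (forn 6 searchStep)).run s) ∧
      ((S' = S ∧ ∀ v w, S.ClosedAt G v w) ∨
        (outerCard S < outerCard S' ∧ ¬ ∀ v w, S.ClosedAt G v w)) := by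
  obtain ⟨s', h1, -, hrun⟩ := forn_induction (x := 5) (p := forn 6 searchStep) s
    (fun j s' => Progress G M r S (fun v' _ => (v' : ℕ) < j) s')
    (.inr ⟨S, h, .inl ⟨rfl, fun v w hd => absurd hd (Nat.not_lt_zero _)⟩⟩) (by decide) rfl (by
    intro j s' hj hs' h1
    rw [h.env.size] at hj
    exact searchRow_run (v := ⟨j, hj⟩) (h1.setVar (by decide) (by decide) j) (by simp))
  rw [hrun]
  have := (h1.setVar (x := 5) (by decide) (by decide) (s.var 0)).mono (done' := fun _ _ => True)
    fun v' w' _ => by rw [h.env.size]; exact v'.2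
  simpa [Progress] using this

theorem Found.searchRound (h : Found G M r s) :
    Found G M r ((forn 5 (forn 6 RAM.Cmd.searchStep)).run s) := by
  obtain ⟨s₁, h1, -, hrun⟩ := forn_induction (x := 5) (p := forn 6 RAM.Cmd.searchStep) s
    (fun _ s₁ => Found G M r s₁) h (by decide) rfl (by
      intro j₁ s₁ _ _ hf
      have hf : Found G M r (s₁.setVar 5 j₁) := hf.congr (by simp) (by simp) rfl
      obtain ⟨s₂, h1, -, hrun⟩ := forn_induction (x := 6) (p := RAM.Cmd.searchStep)
        (s₁.setVar 5 j₁) (fun _ s₁ => Found G M r s₁) hf (by decide) rfl (by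
          intro j₂ s₂ _ _ hf
          have hf : Found G M r (s₂.setVar 6 j₂) := hf.congr (by simp) (by simp) rfl
          rwa [hf.searchStep])
      rw [hrun]
      exact h1.congr (by simp) (by simp) rfl)
  rw [hrun]
  exact h1.congr (by simp) (by simp) rfl

theorem Found.searchLoop (h : Found G M r s) :
    Found G M r ((forn 4 (forn 5 (forn 6 RAM.Cmd.searchStep))).run s) := by
  obtain ⟨s₁, h1, -, hrun⟩ := forn_induction (x := 4) (p := forn 5 (forn 6 RAM.Cmd.searchStep)) s
    (fun _ s₁ => Found G M r s₁) h (by decide) rfl (by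
      intro j s' _ _ hf
      have hf : Found G M r (s'.setVar 4 j) := hf.congr (by simp) (by simp) rfl
      exact hf.searchRound)
  rw [hrun]
  exact h1.congr (by simp) (by simp) rfl

theorem outerCard_le (S : Search (Fin n)) : outerCard S ≤ n := by
  classical
  exact (Finset.card_le_univ _).trans_eq (Fintype.card_fin n)

/-- A round that does not close the search adds at least one outer vertex. The root is outer from
the start, so `n` unsuccessful rounds would produce `n + 1` outer vertices. -/
theorem searchLoop_run (h : Searching G M r S s) :
    Found G M r ((forn 4 (forn 5 (forn 6 searchStep))).run s) ∨ ∃ S',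
      Searching G M r S' ((forn 4 (forn 5 (forn 6 searchStep))).run s) ∧
      ∀ v w, S'.ClosedAt G v w := by
  classical
  obtain ⟨s', h1, -, hrun⟩ := forn_induction (x := 4) (p := forn 5 (forn 6 searchStep)) s
    (fun j s' => Found G M r s' ∨ ∃ S', Searching G M r S' s' ∧
      ((∀ v w, S'.ClosedAt G v w) ∨ j + 1 ≤ outerCard S'))
    (.inr ⟨S, h, .inr (Finset.card_pos.2 ⟨r, by simpa using h.inv.root_outer⟩)⟩) (by decide) rfl (by
    intro j s' hj hs' h1
    rcases h1 with h1 | ⟨S', h1, h2⟩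
    · left
      have hf : Found G M r (s'.setVar 4 j) := h1.congr (by simp) (by simp) rfl
      exact hf.searchRound
    · have hs : Searching G M r S' (s'.setVar 4 j) := h1.congr (by simp) (by simp) rfl
      rcases searchRound_run hs with hf | ⟨S'', h3, ⟨rfl, h4⟩ | ⟨h4, h5⟩⟩
      · exact .inl hf
      · exact .inr ⟨_, h3, .inl h4⟩
      -- Progress in this round excludes that the earlier stage was closed, so the earlier count
      -- applies.
      · refine .inr ⟨S'', h3, .inr ?_⟩
        have := h2.resolve_left h5
        omega)
  rw [hrun]
  rcases h1 with h1 | ⟨S', h1, h2⟩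
  · exact .inl (h1.congr (by simp) (by simp) rfl)
  · refine .inr ⟨S', h1.congr (by simp) (by simp) rfl, h2.resolve_right ?_⟩
    have := outerCard_le S'
    rw [h.env.size]
    omega

/-- A root that is already covered counts as found: the variable `9` starts nonzero, and the loops
then leave the matching alone. -/
theorem searchInit_run (henv : Env G s) (hM : Holds M s) (hmate : IsMate G M) (h3 : s.var 3 = r) :
    Found G M r (searchInit.run s) ∨ Searching G M r (Search.init M r) (searchInit.run s) := by
  obtain ⟨s₁, hs₁⟩ : ∃ s₁, s₁ = (store 3 (var 3) (lit 1)).run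
    ((forn 7 (store 3 (var 7) (lit 0))).run s) := ⟨_, rfl⟩
  have e₁ : Env G s₁ := hs₁ ▸ (henv.run _ rfl rfl rfl).run _ rfl rfl rfl
  have v₁ : s₁.var 3 = r := by rw [hs₁, Cmd.run_var _ rfl, Cmd.run_var _ rfl, h3]
  have w₁ : ∀ i : Fin n, s₁.arr 3 i = if i = r then 1 else 0 := by
    intro i
    have := forn_store_vec (x := 7) (k := 3) (p := store 3 (var 7) (lit 0)) (s := s) henv.size
      (fun _ => 0) (by decide) rfl (by
        intro i s' hi _ _ l j
        simp [Cmd.run, Expr.eval, hi]) i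
    have h3' : ((forn 7 (store 3 (var 7) (lit 0))).run s).var 3 = r := by
      rw [Cmd.run_var _ rfl, h3]
    rw [hs₁, Cmd.run]
    simp [Expr.eval, h3', this, Fin.val_inj]
  have m₁ : Holds M s₁ := hM.congr (by rw [hs₁, Cmd.run_arr _ rfl, Cmd.run_arr _ rfl])
  obtain ⟨s₂, hs₂⟩ : ∃ s₂, s₂ = (forn 7 (forn 8 (store 4 (pos (var 7) (var 8)) (lit 0)))).run s₁ :=
    ⟨_, rfl⟩
  have e₂ : Env G s₂ := hs₂ ▸ e₁.run _ rfl rfl rfl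
  have v₂ : s₂.var 3 = r := by rw [hs₂, Cmd.run_var _ rfl, v₁]
  have a₂ : ∀ l, l ≠ 4 → s₂.arr l = s₁.arr l := by
    intro l hl
    rw [hs₂, Cmd.run_arr _ (by simp [Cmd.stores, hl.symm])]
  have w₂ : ∀ i j : Fin n, s₂.arr 4 (i * n + j) = 0 := by
    obtain ⟨s', ⟨-, h1⟩, -, hrun⟩ := forn_induction (x := 7)
      (p := forn 8 (store 4 (pos (var 7) (var 8)) (lit 0))) s₁
      (fun m s' => Env G s' ∧ ∀ i j : Fin n, (i : ℕ) < m → s'.arr 4 (i * n + j) = 0)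
      ⟨e₁, fun i j h => absurd h (Nat.not_lt_zero _)⟩ (by decide) rfl (by
      intro m s' hm _ ⟨h1, h2⟩
      rw [e₁.size] at hm
      have h1' : Env G (s'.setVar 7 m) := h1.congr (by simp) rfl rfl
      refine ⟨h1'.run _ rfl rfl rfl, fun i j hi => ?_⟩
      rw [forn_store_row (k := 4) (f := fun _ => 0) h1'.size ⟨m, hm⟩ (by decide) rfl]
      · split_ifs with h
        · rfl
        · refine h2 i j ?_
          rw [← Fin.val_inj] at h
          simp only at h
          omega
      · intro i s'' hi hvar harr _ l j
        have h7 : s''.var 7 = m := (hvar 7 (by decide) rfl).trans (by simp)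
        have hoff : s''.arr 6 m = m * n := by
          rw [harr 6 (by decide)]
          exact h1'.offset ⟨m, hm⟩
        simp [Cmd.run, Expr.eval, Expr.pos, hi, h7, hoff])
    intro i j
    rw [hs₂, hrun, State.setVar_arr, h1]
    rw [e₁.size]
    exact i.2
  obtain ⟨s₃, hs₃⟩ : ∃ s₃, s₃ = (forn 8 (store 5 (pos (var 3) (var 8)) (get 2 (var 8)))).run s₂ :=
    ⟨_, rfl⟩
  have e₃ : Env G s₃ := hs₃ ▸ e₂.run _ rfl rfl rfl
  have v₃ : s₃.var 3 = r := by rw [hs₃, Cmd.run_var _ rfl, v₂]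
  have a₃ : ∀ l, l ≠ 5 → s₃.arr l = s₂.arr l := by
    intro l hl
    rw [hs₃, Cmd.run_arr _ (by simp [Cmd.stores, hl.symm])]
  have m₂ : Holds M s₂ := m₁.congr (a₂ 2 (by decide))
  have m₃ : Holds M s₃ := m₂.congr (a₃ 2 (by decide))
  have w₃ : ∀ i j : Fin n, s₃.arr 5 (i * n + j) = if i = r then (M j : ℕ) else s₂.arr 5 (i * n + j) := by
    rw [hs₃]
    refine forn_store_row (f := fun j => (M j : ℕ)) e₂.size r (by decide) rfl ?_
    intro i s' hi hvar harr _ l j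
    have h3' : s'.var 3 = r := (hvar 3 (by decide) rfl).trans v₂
    have hoff : s'.arr 6 r = r * n := by rw [harr 6 (by decide), e₂.offset]
    have hM' : s'.arr 2 i = M i := by rw [harr 2 (by decide), m₂]
    simp [Cmd.run, Expr.eval, Expr.pos, hi, h3', hoff, hM']
  have hfin : searchInit.run s = s₃.setVar 9 ((dist (get 2 (var 3)) (var 3)).eval s₃) := by
    change (Cmd.assign 9 _).run ((forn 8 _).run ((forn 7 _).run ((store 3 _ _).run
      ((forn 7 _).run s)))) = _
    rw [← hs₁, ← hs₂, ← hs₃, Cmd.run]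
  have h9 : (dist (get 2 (var 3)) (var 3)).eval s₃ ≠ 0 ↔ M r ≠ r := by
    rw [eval_dist]
    simp [Expr.eval, v₃, m₃ r, Fin.val_inj]
  have e₄ : Env G (searchInit.run s) := by
    rw [hfin]
    exact e₃.congr (by simp) rfl rfl
  have m₄ : Holds M (searchInit.run s) := by
    rw [hfin]
    exact m₃.congr rfl
  by_cases hr : M r = r
  · refine .inr ⟨e₄, m₄, ?_, Search.inv_init hmate hr, ?_⟩
    · rw [hfin]
      refine Rep.congr (s := s₃) ⟨?_, ?_, ?_⟩ rfl rfl rfl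
      · intro i
        rw [a₃ 3 (by decide), a₂ 3 (by decide), w₁]
        simp [Search.init]
      · intro i j
        rw [a₃ 4 (by decide), w₂]
        simp [Search.init]
      · rintro v rfl x
        rw [w₃, if_pos rfl]
        rfl
    · rw [hfin]
      simpa using mt h9.1 (not_not.2 hr)
  · refine .inl ⟨e₄, ⟨M, m₄, hmate, fun _ h => h, hr⟩, ?_⟩
    rw [hfin]
    simpa using h9.2 hr

/-- No matching covers the vertex `r` together with all vertices that `M` covers. -/
def Stuck (G : SimpleGraph (Fin n)) (M : Fin n → Fin n) (r : Fin n) : Prop :=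
  ∀ g, IsMate G g → (∀ x, M x ≠ x → g x ≠ x) → g r = r

theorem search_run (henv : Env G s) (hM : Holds M s) (hmate : IsMate G M) (h3 : s.var 3 = r) :
    Env G (search.run s) ∧ ∃ M', Holds M' (search.run s) ∧ IsMate G M' ∧
      (∀ x, M x ≠ x → M' x ≠ x) ∧ (M' r = r → Stuck G M' r) := by
  have hrun : search.run s =
    (forn 4 (forn 5 (forn 6 searchStep))).run (searchInit.run s) := rfl
  have key : Found G M r (search.run s) ∨ ∃ S', Searching G M r S' (search.run s) ∧
      ∀ v w, S'.ClosedAt G v w := by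
    rw [hrun]
    rcases searchInit_run henv hM hmate h3 with h | h
    · exact .inl h.searchLoop
    · exact searchLoop_run h
  rcases key with h | ⟨S', h, hcl⟩
  · obtain ⟨M', h1, h2, h3, h4⟩ := h.found
    exact ⟨h.env, M', h1, h2, h3, fun h => absurd h h4⟩
  · refine ⟨h.env, M, h.holds, hmate, fun _ h => h, fun hr g hg hcov => ?_⟩
    -- Some outer vertex is exposed by `g`. It cannot be covered by `M`, and the only outer vertex
    -- exposed by `M` is the root.
    obtain ⟨x, hx, hgx⟩ := h.inv.not_covered hcl hg
    by_cases hMx : M x = x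
    · rwa [h.inv.reached_exposed x (.inl hx) hMx] at hgx
    · exact absurd hgx (hcov x hMx)

theorem prepare_run (a b : ℕ) : Env G (prepare.run (inputState G a b)) ∧
    Holds (fun x : Fin n => x) (prepare.run (inputState G a b)) := by
  obtain ⟨s, hs⟩ : ∃ s, s = inputState G a b := ⟨_, rfl⟩
  rw [← hs]
  have h0 : s.var 0 = n := by simp [hs, inputState]
  obtain ⟨s', ⟨-, h1⟩, -, hrun⟩ := forn_induction (x := 7)
    (p := store 6 (var 7) (var 11) ;; assign 11 (add (var 11) (var 0))) s
    (fun m s' => s'.var 11 = m * n ∧ ∀ i < m, s'.arr 6 i = i * n)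
    ⟨by simp [hs, inputState], fun _ h => absurd h (Nat.not_lt_zero _)⟩ (by decide) rfl (by
    intro m s' hm h0' ⟨h1, h2⟩
    refine ⟨?_, fun i hi => ?_⟩
    · simp [Cmd.run, Expr.eval, h1, h0', h0, Nat.succ_mul]
    · by_cases him : i = m
      · simp [Cmd.run, Expr.eval, him, h1]
      · simp [Cmd.run, Expr.eval, him, h2 i (by omega)])
  have hrun' : prepare.run s = (forn 7 (store 2 (var 7) (var 7))).run
    ((forn 7 (store 6 (var 7) (var 11) ;; assign 11 (add (var 11) (var 0)))).run s) := rfl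
  refine ⟨⟨?_, ?_, ?_⟩, ?_⟩
  · rw [Cmd.run_var _ rfl, h0]
  · intro i j
    rw [Cmd.run_arr _ rfl, hs]
    have : (∃ i' j' : Fin n, (i : ℕ) * n + j = i' * n + j' ∧ G.Adj i' j') ↔ G.Adj i j := by
      constructor
      · rintro ⟨i', j', h, hadj⟩
        obtain ⟨h1, h2⟩ := (pos_inj j.2 j'.2).1 h
        rwa [Fin.ext h1, Fin.ext h2]
      · exact fun h => ⟨i, j, rfl, h⟩
    simp [inputState, this]
  · intro i
    rw [hrun', Cmd.run_arr _ rfl, hrun, State.setVar_arr, h1 i (by rw [h0]; exact i.2)]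
  · intro i
    rw [hrun']
    refine forn_store_vec (f := fun i => (i : ℕ)) (by rw [Cmd.run_var _ rfl, h0]) (by decide) rfl ?_ i
    intro i s' hi _ _ l j
    simp [Cmd.run, Expr.eval, hi]

/-- Later searches only enlarge the set of covered vertices. A matching that refuted `Stuck` for the
final matching would refute it for the earlier one too, so each vertex needs only one search. -/
theorem matching_run (G : SimpleGraph (Fin n)) (a b : ℕ) :
    Env G (matching.run (inputState G a b)) ∧ ∃ M, Holds M (matching.run (inputState G a b)) ∧
      IsMate G M ∧ ∀ r, M r = r → Stuck G M r := by
  obtain ⟨h1, h2⟩ := prepare_run (G := G) a b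
  have hrun : matching.run (inputState G a b) =
    (forn 3 search).run (prepare.run (inputState G a b)) := rfl
  rw [hrun]
  obtain ⟨s', ⟨h3, M, h4, h5, h6⟩, -, hrun⟩ := forn_induction (x := 3) (p := search)
    (prepare.run (inputState G a b)) (fun m s' => Env G s' ∧ ∃ M, Holds M s' ∧ IsMate G M ∧
      ∀ r : Fin n, (r : ℕ) < m → M r = r → Stuck G M r)
    ⟨h1, _, h2, IsMate.id G, fun _ h => absurd h (Nat.not_lt_zero _)⟩ (by decide) rfl (by
    intro m s' hm h0 ⟨h3, M, h4, h5, h6⟩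
    rw [h1.size] at hm
    obtain ⟨k1, M', k2, k3, k4, k5⟩ := search_run (r := ⟨m, hm⟩) (s := s'.setVar 3 m)
      (h3.congr (by simp) rfl rfl) (h4.congr rfl) h5 (by simp)
    refine ⟨k1, M', k2, k3, fun r hr hMr => ?_⟩
    rcases Nat.lt_succ_iff_lt_or_eq.1 hr with hr | hr
    · have hMr' : M r = r := by
        by_contra h
        exact k4 r h hMr
      exact fun g hg hcov => h6 r hr hMr' g hg fun x hx => hcov x (k4 x hx)
    · obtain rfl : r = ⟨m, hm⟩ := Fin.ext hr
      exact k5 hMr)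
  rw [hrun]
  exact ⟨h3.congr (by simp) rfl rfl, M, h4.congr rfl, h5,
    fun r => h6 r (by rw [h1.size]; exact r.2)⟩

end RAM

/-! ### Lists of disjoint edges -/

section Pairs

variable {V : Type*}

/-- The vertices of the edges in a list. -/
def pairVerts (ps : List (V × V)) : List V := ps.flatMap fun p => [p.1, p.2]

@[simp] theorem pairVerts_nil : pairVerts ([] : List (V × V)) = [] := rfl

@[simp] theorem pairVerts_cons (p : V × V) (ps : List (V × V)) :
    pairVerts (p :: ps) = p.1 :: p.2 :: pairVerts ps := by
  simp [pairVerts]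

@[simp] theorem pairVerts_append (ps qs : List (V × V)) :
    pairVerts (ps ++ qs) = pairVerts ps ++ pairVerts qs := by
  simp [pairVerts]

theorem mem_pairVerts {ps : List (V × V)} {x : V} :
    x ∈ pairVerts ps ↔ ∃ p ∈ ps, x = p.1 ∨ x = p.2 := by
  simp [pairVerts]

theorem length_pairVerts (ps : List (V × V)) : (pairVerts ps).length = 2 * ps.length := by
  induction ps with
  | nil => rfl
  | cons p ps ih =>
    simp only [pairVerts_cons, List.length_cons, ih]
    omega

theorem pairVerts_unique {ps : List (V × V)} (h : (pairVerts ps).Nodup) {p q : V × V} (hp : p ∈ ps)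
    (hq : q ∈ ps) {x : V} (hxp : x = p.1 ∨ x = p.2) (hxq : x = q.1 ∨ x = q.2) : p = q := by
  induction ps with
  | nil => simp at hp
  | cons y ps ih =>
    simp only [pairVerts_cons, List.nodup_cons, List.mem_cons, not_or] at h
    have key : ∀ q ∈ ps, ¬ ((x = y.1 ∨ x = y.2) ∧ (x = q.1 ∨ x = q.2)) := by
      rintro q hq ⟨h1, h2⟩
      have hm : x ∈ pairVerts ps := mem_pairVerts.2 ⟨q, hq, h2⟩
      rcases h1 with rfl | rfl
      exacts [h.1.2 hm, h.2.1 hm]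
    rcases List.mem_cons.1 hp with hp' | hp' <;> rcases List.mem_cons.1 hq with hq' | hq'
    · rw [hp', hq']
    · exact absurd ⟨hp' ▸ hxp, hxq⟩ (key q hq')
    · exact absurd ⟨hq' ▸ hxq, hxp⟩ (key p hp')
    · exact ih h.2.2 hp' hq'

theorem pairVerts_ne {ps : List (V × V)} (h : (pairVerts ps).Nodup) {p : V × V} (hp : p ∈ ps) :
    p.1 ≠ p.2 := by
  induction ps with
  | nil => simp at hp
  | cons y ps ih =>
    simp only [pairVerts_cons, List.nodup_cons, List.mem_cons, not_or] at h
    rcases List.mem_cons.1 hp with rfl | hp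
    exacts [h.1.1, ih h.2.2 hp]

theorem nodup_of_pairVerts {ps : List (V × V)} (h : (pairVerts ps).Nodup) : ps.Nodup := by
  induction ps with
  | nil => simp
  | cons y ps ih =>
    simp only [pairVerts_cons, List.nodup_cons, List.mem_cons, not_or] at h
    exact List.nodup_cons.2 ⟨fun hy => h.1.2 (mem_pairVerts.2 ⟨y, hy, .inl rfl⟩), ih h.2.2⟩

theorem edge_inj_of_pairVerts {ps : List (V × V)} (h : (pairVerts ps).Nodup) {p q : V × V}
    (hp : p ∈ ps) (hq : q ∈ ps) (e : s(p.1, p.2) = s(q.1, q.2)) : p = q := by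
  refine pairVerts_unique h hp hq (x := p.1) (.inl rfl) ?_
  rcases Sym2.eq_iff.1 e with e | e
  exacts [.inl e.1, .inr e.1]

variable {G : SimpleGraph V}

/-- The edges of the subgraph `M` are listed in `ps`. -/
structure ListsEdges (M : G.Subgraph) (ps : List (V × V)) : Prop where
  adj : ∀ u v, M.Adj u v ↔ (u, v) ∈ ps ∨ (v, u) ∈ ps
  nodup : (pairVerts ps).Nodup

theorem ListsEdges.edgeSet {M : G.Subgraph} {ps : List (V × V)} (h : ListsEdges M ps) :
    M.edgeSet = (fun p : V × V => s(p.1, p.2)) '' {p | p ∈ ps} := by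
  ext e
  induction e with | _ u v
  rw [SimpleGraph.Subgraph.mem_edgeSet, h.adj]
  simp only [Set.mem_image, Set.mem_ofPred_eq, Sym2.eq_iff, Prod.exists]
  constructor
  · rintro (h | h)
    exacts [⟨u, v, h, .inl ⟨rfl, rfl⟩⟩, ⟨v, u, h, .inr ⟨rfl, rfl⟩⟩]
  · rintro ⟨x, y, h, ⟨rfl, rfl⟩ | ⟨rfl, rfl⟩⟩
    exacts [.inl h, .inr h]

theorem ListsEdges.ncard_edgeSet {M : G.Subgraph} {ps : List (V × V)} (h : ListsEdges M ps) :
    M.edgeSet.ncard = ps.length := by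
  classical
  have hinj : Set.InjOn (fun p : V × V => s(p.1, p.2)) {p | p ∈ ps} :=
    fun p hp q hq e => edge_inj_of_pairVerts h.nodup hp hq e
  rw [h.edgeSet, hinj.ncard_image,
    ← List.toFinset_card_of_nodup (nodup_of_pairVerts h.nodup), ← Set.ncard_coe_finset]
  congr 1
  ext p
  simp

/-- The subgraph with the edges in a list. -/
def pairSubgraph (ps : List (V × V)) (hadj : ∀ p ∈ ps, G.Adj p.1 p.2) : G.Subgraph where
  verts := {x | x ∈ pairVerts ps}
  Adj u v := (u, v) ∈ ps ∨ (v, u) ∈ ps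
  adj_sub := by
    rintro u v (h | h)
    exacts [hadj _ h, (hadj _ h).symm]
  edge_vert := by
    rintro u v (h | h)
    exacts [mem_pairVerts.2 ⟨_, h, .inl rfl⟩, mem_pairVerts.2 ⟨_, h, .inr rfl⟩]
  symm := ⟨fun _ _ h => h.symm⟩

theorem listsEdges_pairSubgraph {ps : List (V × V)} (hadj : ∀ p ∈ ps, G.Adj p.1 p.2)
    (hnd : (pairVerts ps).Nodup) : ListsEdges (pairSubgraph ps hadj) ps :=
  ⟨fun _ _ => Iff.rfl, hnd⟩

theorem isMatching_pairSubgraph {ps : List (V × V)} (hadj : ∀ p ∈ ps, G.Adj p.1 p.2)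
    (hnd : (pairVerts ps).Nodup) : (pairSubgraph ps hadj).IsMatching := by
  intro x hx
  obtain ⟨⟨u, v⟩, hp, h⟩ := mem_pairVerts.1 hx
  have hne := pairVerts_ne hnd hp
  simp only at h hne
  have key : ∀ y, (pairSubgraph ps hadj).Adj x y → (x, y) = (u, v) ∨ (y, x) = (u, v) := by
    rintro y (hy | hy)
    · exact .inl (pairVerts_unique hnd hy hp (x := x) (.inl rfl) h)
    · exact .inr (pairVerts_unique hnd hy hp (x := x) (.inr rfl) h)
  rcases h with rfl | rfl
  · refine ⟨v, .inl hp, fun y hy => ?_⟩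
    have := key y hy
    grind
  · refine ⟨u, .inr hp, fun y hy => ?_⟩
    have := key y hy
    grind

/-- Maximality in the form used by the lower bounds, where the competing matchings arise as lists of
disjoint edges. -/
theorem length_le_of_isMaximumMatching {M : G.Subgraph} (hM : IsMaximumMatching M)
    {ps qs : List (V × V)} (hps : ListsEdges M ps) (hadj : ∀ p ∈ qs, G.Adj p.1 p.2)
    (hnd : (pairVerts qs).Nodup) : qs.length ≤ ps.length := by
  have := hM.2 _ (isMatching_pairSubgraph hadj hnd)
  rwa [(listsEdges_pairSubgraph hadj hnd).ncard_edgeSet, hps.ncard_edgeSet] at this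

end Pairs

/-! ### Translation between involutions, edge lists and matching subgraphs. -/

section MatePairs

variable {n : ℕ} {G : SimpleGraph (Fin n)} {f : Fin n → Fin n}

/-- The smaller vertices of the edges of a matching. -/
def mateFirsts (f : Fin n → Fin n) : List (Fin n) := (List.finRange n).filter fun x => x < f x

/-- The edges of a matching. -/
def matePairs (f : Fin n → Fin n) : List (Fin n × Fin n) := (mateFirsts f).map fun x => (x, f x)

/-- The exposed vertices. -/
def mateRest (f : Fin n → Fin n) : List (Fin n) := (List.finRange n).filter fun x => f x = x

theorem mem_matePairs {p : Fin n × Fin n} : p ∈ matePairs f ↔ p.1 < p.2 ∧ p.2 = f p.1 := by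
  simp only [matePairs, mateFirsts, List.mem_map, List.mem_filter, List.mem_finRange, true_and,
    decide_eq_true_eq]
  constructor
  · rintro ⟨x, h, rfl⟩
    exact ⟨h, rfl⟩
  · rintro ⟨h1, h2⟩
    exact ⟨p.1, by rwa [← h2], by rw [← h2]⟩

theorem mem_matePairs_or (hf : IsMate G f) {u v : Fin n} :
    (u, v) ∈ matePairs f ∨ (v, u) ∈ matePairs f ↔ f u = v ∧ u ≠ v := by
  simp only [mem_matePairs]
  have h1 := hf.invol u
  have h2 := hf.invol v
  grind

theorem mem_pairVerts_matePairs (hf : IsMate G f) {x : Fin n} :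
    x ∈ pairVerts (matePairs f) ↔ f x ≠ x := by
  rw [mem_pairVerts]
  constructor
  · rintro ⟨p, hp, h⟩
    rw [mem_matePairs] at hp
    have := hf.invol p.1
    grind
  · intro h
    rcases lt_or_gt_of_ne h with h | h
    · exact ⟨(f x, x), mem_matePairs.2 ⟨h, (hf.invol x).symm⟩, .inr rfl⟩
    · exact ⟨(x, f x), mem_matePairs.2 ⟨h, rfl⟩, .inl rfl⟩

theorem nodup_matePairs (hf : IsMate G f) : (pairVerts (matePairs f)).Nodup := by
  have h1 : (mateFirsts f).Nodup := (List.nodup_finRange n).filter _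
  have h2 : ∀ x ∈ mateFirsts f, x < f x := by simp [mateFirsts]
  have hff := hf.invol
  unfold matePairs
  generalize mateFirsts f = l at h1 h2
  induction l with
  | nil => simp
  | cons x l ih =>
    rw [List.nodup_cons] at h1
    have hx := h2 x (by simp)
    have hl : ∀ y ∈ l, y < f y := fun y hy => h2 y (by simp [hy])
    simp only [List.map_cons, pairVerts_cons, List.nodup_cons, List.mem_cons, not_or]
    refine ⟨⟨hx.ne, fun h => ?_⟩, fun h => ?_, ih h1.2 hl⟩ <;>
    · obtain ⟨p, hp, h⟩ := mem_pairVerts.1 h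
      obtain ⟨y, hy, rfl⟩ := List.mem_map.1 hp
      have := hl y hy
      have := hff x
      have := hff y
      grind

theorem nodup_mateRest (f : Fin n → Fin n) : (mateRest f).Nodup :=
  (List.nodup_finRange n).filter _

theorem mem_mateRest {x : Fin n} : x ∈ mateRest f ↔ f x = x := by simp [mateRest]

theorem card_support (hf : IsMate G f) :
    (Finset.univ.filter fun x => f x ≠ x).card = 2 * (matePairs f).length := by
  rw [← length_pairVerts, ← List.toFinset_card_of_nodup (nodup_matePairs hf)]
  congr 1
  ext x
  simp [mem_pairVerts_matePairs hf]

theorem matePairs_adj (hf : IsMate G f) : ∀ p ∈ matePairs f, G.Adj p.1 p.2 := by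
  intro p hp
  obtain ⟨h1, h2⟩ := mem_matePairs.1 hp
  rw [h2]
  exact hf.adj _ (by rw [← h2]; exact h1.ne')

/-- A matching as a subgraph. -/
def mateSubgraph (hf : IsMate G f) : G.Subgraph := pairSubgraph (matePairs f) (matePairs_adj hf)

theorem exists_isMate {M : G.Subgraph} (hM : M.IsMatching) :
    ∃ g, IsMate G g ∧ ListsEdges M (matePairs g) := by
  classical
  have hM : ∀ x, x ∈ M.verts → ∃ w, M.Adj x w ∧ ∀ y, M.Adj x y → y = w := fun x hx => hM hx
  choose! g hg hg' using hM
  let g' : Fin n → Fin n := fun x => if x ∈ M.verts then g x else x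
  have h1 : ∀ x, x ∈ M.verts → g x ∈ M.verts := fun x hx => M.edge_vert (hg x hx).symm
  have hg1 : IsMate G g' := by
    constructor
    · intro x
      by_cases hx : x ∈ M.verts
      · simp only [g', hx, h1 x hx, if_true]
        exact (hg' _ (h1 x hx) x (hg x hx).symm).symm
      · simp [g', hx]
    · intro x hne
      by_cases hx : x ∈ M.verts
      · simpa [g', hx] using M.adj_sub (hg x hx)
      · simp [g', hx] at hne
  refine ⟨g', hg1, fun u v => ?_, nodup_matePairs hg1⟩
  rw [mem_matePairs_or hg1]
  constructor
  · intro h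
    have hu := M.edge_vert h
    exact ⟨by simp [g', hu, ← hg' u hu v h], h.ne⟩
  · rintro ⟨h, hne⟩
    by_cases hu : u ∈ M.verts
    · rw [← h]
      simpa [g', hu] using hg u hu
    · simp [g', hu] at h
      exact absurd h hne

/-- An involution covers twice as many vertices as it has edges, and every matching subgraph comes
from an involution, so `IsMate.card_le` compares numbers of edges. -/
theorem isMaximumMatching_mateSubgraph (hf : IsMate G f)
    (hmax : ∀ r, f r = r → ∀ g, IsMate G g → (∀ x, f x ≠ x → g x ≠ x) → g r = r) :
    IsMaximumMatching (mateSubgraph hf) := by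
  refine ⟨isMatching_pairSubgraph _ (nodup_matePairs hf), fun M' hM' => ?_⟩
  obtain ⟨g, hg, hl⟩ := exists_isMate hM'
  have := hf.card_le hmax hg
  rw [card_support hf, card_support hg] at this
  rw [hl.ncard_edgeSet, mateSubgraph,
    (listsEdges_pairSubgraph (matePairs_adj hf) (nodup_matePairs hf)).ncard_edgeSet]
  omega

end MatePairs

/-! ### Partial enumerations for the loop invariants of the scheduling program. -/

section FinRange

variable {n : ℕ}

/-- The indices below `m` with a given property. -/
def firstsBelow (n m : ℕ) (P : Fin n → Prop) [DecidablePred P] : List (Fin n) :=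
  ((List.finRange n).take m).filter fun x => P x

variable {P : Fin n → Prop} [DecidablePred P]

theorem firstsBelow_zero : firstsBelow n 0 P = [] := by simp [firstsBelow]

theorem firstsBelow_succ (i : Fin n) :
    firstsBelow n (i + 1) P = firstsBelow n i P ++ if P i then [i] else [] := by
  have h : (List.finRange n).take (i + 1) = (List.finRange n).take i ++ [i] := by
    rw [List.take_add_one]
    simp
  rw [firstsBelow, h, List.filter_append, firstsBelow, List.filter_singleton]
  by_cases hi : P i <;> simp [hi]

theorem firstsBelow_self : firstsBelow n n P = (List.finRange n).filter fun x => P x := by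
  rw [firstsBelow, List.take_of_length_le (by simp)]

theorem lt_of_mem_firstsBelow {m : ℕ} {x : Fin n} (h : x ∈ firstsBelow n m P) :
    (x : ℕ) < m ∧ P x := by
  simp only [firstsBelow, List.mem_filter, decide_eq_true_eq] at h
  refine ⟨?_, h.2⟩
  obtain ⟨i, hi, rfl⟩ := List.mem_iff_getElem.1 h.1
  simp at hi ⊢
  omega

end FinRange

/-! ### Correctness of the starting times and the polynomial time bound. -/

namespace RAM

open Cmd RAM.Expr

variable {n : ℕ} {G : SimpleGraph (Fin n)} {f : Fin n → Fin n} {s : State} {a b : ℕ}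

/-- Each edge is processed once, at its smaller end: the truncated difference `f x - x` is nonzero
exactly there. -/
theorem schedulePairs_run (hf : IsMate G f) (hM : Holds f s) (h0 : s.var 0 = n)
    (h1 : s.var 1 = a) (h15 : s.var 15 = 0) :
    (schedulePairs.run s).var 15 = (mateFirsts f).length * s.var 16 ∧
    ∀ (t : ℕ) (x : Fin n), (mateFirsts f)[t]? = some x →
      (schedulePairs.run s).arr 1 x = t * s.var 16 ∧
      (schedulePairs.run s).arr 1 (f x) = t * s.var 16 + a := by
  obtain ⟨s', ⟨h2, h3, -⟩, -, hrun⟩ := forn_induction (x := 7)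
    (p := ite (sub (get 2 (var 7)) (var 7))
      (store 1 (var 7) (var 15) ;;
       store 1 (get 2 (var 7)) (add (var 15) (var 1)) ;;
       assign 15 (add (var 15) (var 16)))
      skip) s (fun (m : ℕ) (s' : State) =>
      s'.var 15 = (firstsBelow n m fun x => x < f x).length * s.var 16 ∧
      (∀ (t : ℕ) (x : Fin n), (firstsBelow n m fun x => x < f x)[t]? = some x →
        s'.arr 1 x = t * s.var 16 ∧ s'.arr 1 (f x) = t * s.var 16 + a) ∧
      s'.var 1 = a ∧ s'.var 16 = s.var 16 ∧ Holds f s')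
    (by simp [firstsBelow_zero, h15, h1, hM]) (by decide) rfl (by
    intro m s' hm _ ⟨i1, i2, i3, i4, i5⟩
    rw [h0] at hm
    obtain ⟨i, rfl⟩ : ∃ i : Fin n, (i : ℕ) = m := ⟨⟨m, hm⟩, rfl⟩
    have hff := hf.invol
    rw [Cmd.run]
    have hcond : (sub (get 2 (var 7)) (var 7)).eval (s'.setVar 7 i) ≠ 0 ↔ i < f i := by
      simp only [Expr.eval, State.setVar_var, State.setVar_arr, if_true, i5 i]
      rw [Fin.lt_def]
      omega
    by_cases hi : i < f i
    · rw [if_pos (hcond.2 hi), firstsBelow_succ, if_pos hi]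
      have hi' : (i : ℕ) ≠ f i := fun h => hi.ne (Fin.ext h)
      simp only [Cmd.run, Expr.eval, State.setVar_var, State.setVar_arr, State.setArr_arr,
        State.setArr_var, if_true, i5 i, Nat.reduceEqDiff, if_false, i1, i3, i4,
        List.length_append, List.length_singleton]
      refine ⟨by ring, ?_, by simp, by simp, ?_⟩
      · intro t x hx
        rw [List.getElem?_append] at hx
        split_ifs at hx with ht
        · have hmem := List.mem_of_getElem? hx
          obtain ⟨k1, k2⟩ := lt_of_mem_firstsBelow hmem
          -- The current edge is disjoint from the earlier ones, so the two new entries overwrite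
          -- none of theirs.
          have n1 : (x : ℕ) ≠ i := k1.ne
          have n2 : (x : ℕ) ≠ f i := by
            have : (i : ℕ) < f i := hi
            omega
          have n3 : (f x : ℕ) ≠ i := fun h => by
            have h : f x = i := Fin.ext h
            have : f i = x := by rw [← h, hff]
            rw [this, Fin.lt_def] at hi
            omega
          have n4 : (f x : ℕ) ≠ f i := fun h => n1 (by rw [hf.injective (Fin.ext h)])
          simpa [n1, n2, n3, n4] using i2 t x hx
        · obtain ⟨rfl, ht'⟩ : i = x ∧ t = (firstsBelow n i fun x => x < f x).length := by
            rw [List.getElem?_singleton] at hx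
            split_ifs at hx with h
            exact ⟨by simpa using hx, by omega⟩
          simp [hi', ht']
      · intro j
        simp [i5 j]
    · rw [if_neg (mt hcond.1 hi), firstsBelow_succ, if_neg hi, List.append_nil]
      exact ⟨by simp [Cmd.run, i1], by simpa [Cmd.run] using i2, by simp [Cmd.run, i3],
        by simp [Cmd.run, i4], i5.congr rfl⟩)
  have hrun' : schedulePairs.run s = s'.setVar 7 (s.var 0) := hrun
  rw [h0, firstsBelow_self] at h2 h3
  rw [hrun']
  exact ⟨by simpa [mateFirsts] using h2, h3⟩

theorem scheduleRest_run (hM : Holds f s) (h0 : s.var 0 = n) :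
    (∀ (t : ℕ) (x : Fin n), (mateRest f)[t]? = some x →
      (scheduleRest.run s).arr 1 x = s.var 15 + t * s.var 17) ∧
    ∀ x, f x ≠ x → (scheduleRest.run s).arr 1 x = s.arr 1 x := by
  obtain ⟨s', ⟨-, h3, h4, -⟩, -, hrun⟩ := forn_induction (x := 7)
    (p := ite (dist (get 2 (var 7)) (var 7)) skip
      (store 1 (var 7) (var 15) ;;
       assign 15 (add (var 15) (var 17)))) s (fun (m : ℕ) (s' : State) =>
      s'.var 15 = s.var 15 + (firstsBelow n m fun x => f x = x).length * s.var 17 ∧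
      (∀ (t : ℕ) (x : Fin n), (firstsBelow n m fun x => f x = x)[t]? = some x →
        s'.arr 1 x = s.var 15 + t * s.var 17) ∧
      (∀ x, f x ≠ x → s'.arr 1 x = s.arr 1 x) ∧ s'.var 17 = s.var 17 ∧ Holds f s')
    (by simp [firstsBelow_zero, hM]) (by decide) rfl (by
    intro m s' hm _ ⟨i1, i2, i3, i4, i5⟩
    rw [h0] at hm
    obtain ⟨i, rfl⟩ : ∃ i : Fin n, (i : ℕ) = m := ⟨⟨m, hm⟩, rfl⟩
    rw [Cmd.run]
    have hcond : (dist (get 2 (var 7)) (var 7)).eval (s'.setVar 7 i) ≠ 0 ↔ f i ≠ i := by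
      rw [eval_dist]
      simp [Expr.eval, i5 i, Fin.val_inj]
    by_cases hi : f i = i
    · rw [if_neg (mt hcond.1 (not_not.2 hi)), firstsBelow_succ, if_pos hi]
      simp only [Cmd.run, Expr.eval, State.setVar_var, State.setVar_arr, State.setArr_arr,
        State.setArr_var, if_true, Nat.reduceEqDiff, if_false, i1, i4,
        List.length_append, List.length_singleton]
      refine ⟨by ring, ?_, ?_, by simp, ?_⟩
      · intro t x hx
        rw [List.getElem?_append] at hx
        split_ifs at hx with ht
        · have hmem := List.mem_of_getElem? hx
          have n1 : (x : ℕ) ≠ i := (lt_of_mem_firstsBelow hmem).1.ne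
          simpa [n1] using i2 t x hx
        · obtain ⟨rfl, ht'⟩ : i = x ∧ t = (firstsBelow n i fun x => f x = x).length := by
            rw [List.getElem?_singleton] at hx
            split_ifs at hx with h
            exact ⟨by simpa using hx, by omega⟩
          simp [ht']
      · intro x hx
        have n1 : (x : ℕ) ≠ i := fun h => hx (by rw [Fin.ext h, hi])
        simpa [n1] using i3 x hx
      · intro j
        simp [i5 j]
    · rw [if_pos (hcond.2 hi), firstsBelow_succ, if_neg hi, List.append_nil]
      exact ⟨by simp [Cmd.run, i1], by simpa [Cmd.run] using i2, by simpa [Cmd.run] using i3,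
        by simp [Cmd.run, i4], i5.congr rfl⟩)
  have hrun' : scheduleRest.run s = s'.setVar 7 (s.var 0) := hrun
  rw [h0, firstsBelow_self] at h3
  rw [hrun']
  exact ⟨h3, h4⟩

theorem schedule_run (hf : IsMate G f) (hM : Holds f s) (h0 : s.var 0 = n) (h1 : s.var 1 = a)
    (h2 : s.var 2 = b) :
    IsMatchingSchedule (mateSubgraph hf) a b (outputSchedule n (schedule.run s)) := by
  obtain ⟨s₁, hs₁⟩ : ∃ s₁, s₁ = (assign 15 (lit 0) ;;
    assign 17 (add (add (var 1) (var 1)) (add (var 2) (var 2))) ;;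
    assign 16 (add (var 1) (var 17))).run s := ⟨_, rfl⟩
  have v15 : s₁.var 15 = 0 := by simp [hs₁, Cmd.run, Expr.eval]
  have v17 : s₁.var 17 = 2 * a + 2 * b := by
    simp [hs₁, Cmd.run, Expr.eval, h1, h2]
    ring
  have v16 : s₁.var 16 = 3 * a + 2 * b := by
    simp [hs₁, Cmd.run, Expr.eval, h1, h2]
    ring
  have v0 : s₁.var 0 = n := by rw [hs₁, Cmd.run_var _ rfl, h0]
  have v1 : s₁.var 1 = a := by rw [hs₁, Cmd.run_var _ rfl, h1]
  have m₁ : Holds f s₁ := hM.congr (by rw [hs₁, Cmd.run_arr _ rfl])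
  obtain ⟨k1, k2⟩ := schedulePairs_run hf m₁ v0 v1 v15
  obtain ⟨k3, k4⟩ := scheduleRest_run (s := schedulePairs.run s₁)
    (m₁.congr (Cmd.run_arr _ rfl _)) (by rw [Cmd.run_var _ rfl, v0])
  have hfin : schedule.run s = scheduleRest.run (schedulePairs.run s₁) := by
    rw [hs₁]
    rfl
  rw [← hfin] at k3 k4
  rw [Cmd.run_var (y := 17) _ rfl, k1, v16, v17] at k3
  rw [v16] at k2
  have hne : ∀ x ∈ mateFirsts f, f x ≠ x := by
    intro x hx
    simp only [mateFirsts, List.mem_filter, decide_eq_true_eq] at hx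
    exact hx.2.ne'
  have hlen : (matePairs f).length = (mateFirsts f).length := by simp [matePairs]
  refine ⟨matePairs f, mateRest f, fun _ _ => Iff.rfl, ?_, ?_, ?_, ?_⟩
  · intro v
    rw [mem_mateRest]
    change _ ↔ ¬ (v ∈ pairVerts (matePairs f))
    rw [mem_pairVerts_matePairs hf, not_not]
  · refine List.Nodup.append (nodup_matePairs hf) (nodup_mateRest f) ?_
    intro x hx hx'
    exact (mem_pairVerts_matePairs hf).1 hx (mem_mateRest.1 hx')
  · intro t ht
    rw [hlen] at ht
    obtain ⟨k5, k6⟩ := k2 t _ (List.getElem?_eq_getElem ht)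
    have hx := hne _ (List.getElem_mem ht)
    have hx' : f (f (mateFirsts f)[t]) ≠ f (mateFirsts f)[t] := fun h => hx (hf.injective h)
    simp only [matePairs, List.getElem_map, outputSchedule]
    rw [k4 _ hx, k4 _ hx', k5, k6]
    exact ⟨rfl, rfl⟩
  · intro t ht
    rw [hlen]
    exact k3 t _ (List.getElem?_eq_getElem ht)

/-- The machine program computes the schedule of a maximum matching in polynomial time. -/
theorem exists_prog : ∃ (prog : Prog) (q : Polynomial ℕ),
    ∀ (n a b : ℕ) (G : SimpleGraph (Fin n)), ∃ (t : ℕ) (s : State),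
      Runs prog (inputState G a b) t s ∧ t ≤ q.eval (inputSize n a b) ∧
      ∃ M : G.Subgraph, IsMaximumMatching M ∧ IsMatchingSchedule M a b (outputSchedule n s) := by
  refine ⟨(matching ;; schedule).toProg, (matching ;; schedule).time, fun n a b G => ?_⟩
  obtain ⟨t, hrun, ht⟩ := (matching ;; schedule).runs_toProg (by decide) (by decide)
    (inputState G a b)
  obtain ⟨henv, M, hM, hmate, hmax⟩ := matching_run G a b
  refine ⟨t, _, hrun, ht.trans ?_, mateSubgraph hmate, isMaximumMatching_mateSubgraph hmate hmax,
    schedule_run hmate hM henv.size ?_ ?_⟩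
  · have h0 : (inputState G a b).var 0 = n := by simp [inputState]
    rw [h0]
    -- The step bound depends on `n` only. Having natural coefficients, it is monotone and can be
    -- evaluated at the larger instance size.
    rw [Polynomial.eval_eq_sum_range, Polynomial.eval_eq_sum_range]
    have : n ≤ inputSize n a b := by
      unfold inputSize
      omega
    gcongr
  · rw [Cmd.run_var _ (by decide)]
    simp [inputState]
  · rw [Cmd.run_var _ (by decide)]
    simp [inputState]

end RAM

/-! ### Validity, length and path cover of a matching schedule. -/

section Schedules

variable {n a b : ℕ} {G : SimpleGraph (Fin n)} {σ : Fin n → ℕ}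

/-- Tasks that are executed one after the other or interleaved as adjacent neighbours form a valid
schedule. -/
theorem validSchedule_of_separated {V : Type*} {G : SimpleGraph V} {σ : V → ℕ} (hab : b < a)
    (h : ∀ i j, i ≠ j → σ i ≤ σ j →
      σ i + (2 * a + 2 * b) ≤ σ j ∨ (σ j = σ i + a ∧ G.Adj i j)) :
    ValidSchedule G a b (a + b) σ := by
  have key : ∀ i j, i ≠ j → (σ i + (2 * a + 2 * b) ≤ σ j ∨ (σ j = σ i + a ∧ G.Adj i j)) ∨
      (σ j + (2 * a + 2 * b) ≤ σ i ∨ (σ i = σ j + a ∧ G.Adj i j)) := by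
    intro i j hij
    rcases le_total (σ i) (σ j) with hle | hle
    · exact .inl (h i j hij hle)
    · rcases h j i hij.symm hle with h | h
      exacts [.inr (.inl h), .inr (.inr ⟨h.1, h.2.symm⟩)]
  constructor
  · intro i j hij x y
    have : (σ i + (2 * a + 2 * b) ≤ σ j ∨ σ j = σ i + a) ∨
        (σ j + (2 * a + 2 * b) ≤ σ i ∨ σ i = σ j + a) :=
      (key i j hij).imp (Or.imp_right And.left) (Or.imp_right And.left)
    -- In an interleaved pair the second sub-task of the later task starts at offset `3 a + b`, and
    -- the earlier task ends at `2 a + 2 b`; this needs `b ≤ a`.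
    cases x <;> cases y <;> simp only [subStart, subEnd] <;> omega
  · intro i j hij x h1 h2
    rcases key i j hij with (h | ⟨h, hadj⟩) | (h | ⟨h, hadj⟩)
    · cases x <;> simp only [subStart, subEnd] at h1 h2 <;> omega
    · exact hadj
    · cases x <;> simp only [subStart, subEnd] at h1 h2 <;> omega
    · exact hadj

/-- In a valid schedule, a task starts after the end of an earlier one or in its idle time. -/
theorem ValidSchedule.separated {V : Type*} {G : SimpleGraph V} {σ : V → ℕ}
    (h : ValidSchedule G a b (a + b) σ) (ha : 0 < a) {i j : V} (hij : i ≠ j) (hle : σ i ≤ σ j) :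
    σ i + (2 * a + 2 * b) ≤ σ j ∨ (σ i + a ≤ σ j ∧ σ j ≤ σ i + (a + b) ∧ G.Adj i j) := by
  have h1 := h.noOverlap i j hij false false
  have h2 := h.noOverlap i j hij true false
  have h3 := h.compatible i j hij false
  simp only [subStart, subEnd] at h1 h2 h3
  by_cases hlong : σ i + (2 * a + 2 * b) ≤ σ j
  · exact .inl hlong
  · exact .inr ⟨by omega, by omega, h3 (by omega) (by omega)⟩

/-- The places of a task in the schedule of a matching with edges `pairs`. -/
structure MatchingOrder (M : G.Subgraph) (a b : ℕ) (σ : Fin n → ℕ) (pairs : List (Fin n × Fin n))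
    (rest : List (Fin n)) : Prop where
  listsEdges : ListsEdges M pairs
  nodup_rest : rest.Nodup
  disjoint : ∀ x ∈ pairVerts pairs, x ∉ rest
  cover : ∀ x, x ∈ pairVerts pairs ∨ x ∈ rest
  start_fst : ∀ (t : ℕ) (h : t < pairs.length), σ pairs[t].1 = t * (3 * a + 2 * b)
  start_snd : ∀ (t : ℕ) (h : t < pairs.length), σ pairs[t].2 = t * (3 * a + 2 * b) + a
  start_rest : ∀ (t : ℕ) (h : t < rest.length),
    σ rest[t] = pairs.length * (3 * a + 2 * b) + t * (2 * a + 2 * b)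

theorem IsMatchingSchedule.exists_order {M : G.Subgraph} (hM : M.IsMatching)
    (h : IsMatchingSchedule M a b σ) : ∃ pairs rest, MatchingOrder M a b σ pairs rest := by
  obtain ⟨pairs, rest, h1, h2, h3, h4, h5⟩ := h
  rw [List.nodup_append] at h3
  refine ⟨pairs, rest, ⟨h1, h3.1⟩, h3.2.1, fun x hx hx' => h3.2.2 x hx x hx' rfl, fun x => ?_,
    fun t h => (h4 t h).1, fun t h => (h4 t h).2, h5⟩
  by_cases hx : x ∈ M.verts
  · obtain ⟨w, hw, -⟩ := hM hx
    rcases (h1 x w).1 hw with h | h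
    exacts [.inl (mem_pairVerts.2 ⟨_, h, .inl rfl⟩), .inl (mem_pairVerts.2 ⟨_, h, .inr rfl⟩)]
  · exact .inr ((h2 x).2 hx)

namespace MatchingOrder

variable {M : G.Subgraph} {pairs : List (Fin n × Fin n)} {rest : List (Fin n)}

theorem place (h : MatchingOrder M a b σ pairs rest) (x : Fin n) :
    (∃ (t : ℕ) (ht : t < pairs.length), x = pairs[t].1) ∨
    (∃ (t : ℕ) (ht : t < pairs.length), x = pairs[t].2) ∨
    ∃ (t : ℕ) (ht : t < rest.length), x = rest[t] := by
  rcases h.cover x with hx | hx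
  · obtain ⟨p, hp, hxp⟩ := mem_pairVerts.1 hx
    obtain ⟨t, ht, rfl⟩ := List.mem_iff_getElem.1 hp
    rcases hxp with hxp | hxp
    exacts [.inl ⟨t, ht, hxp⟩, .inr (.inl ⟨t, ht, hxp⟩)]
  · obtain ⟨t, ht, rfl⟩ := List.mem_iff_getElem.1 hx
    exact .inr (.inr ⟨t, ht, rfl⟩)

theorem adj (h : MatchingOrder M a b σ pairs rest) {p : Fin n × Fin n} (hp : p ∈ pairs) :
    G.Adj p.1 p.2 := M.adj_sub ((h.listsEdges.adj _ _).2 (.inl hp))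

theorem separated (h : MatchingOrder M a b σ pairs rest) (ha : 0 < a) : ∀ i j, i ≠ j → σ i ≤ σ j →
    σ i + (2 * a + 2 * b) ≤ σ j ∨ (σ j = σ i + a ∧ G.Adj i j) := by
  intro i j hij hle
  have mul : ∀ c t t' : ℕ, t < t' → t * c + c ≤ t' * c := by
    intro c t t' h
    rw [← Nat.succ_mul]
    exact Nat.mul_le_mul_right c h
  rcases h.place i with ⟨t, ht, rfl⟩ | ⟨t, ht, rfl⟩ | ⟨t, ht, rfl⟩ <;>
    rcases h.place j with ⟨t', ht', rfl⟩ | ⟨t', ht', rfl⟩ | ⟨t', ht', rfl⟩ <;>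
    simp only [h.start_fst, h.start_snd, h.start_rest] at hle ⊢ <;>
    have m1 := mul (3 * a + 2 * b) t t' <;>
    have m2 := mul (3 * a + 2 * b) t' t <;>
    have m3 := mul (2 * a + 2 * b) t t' <;>
    have m4 := mul (2 * a + 2 * b) t' t <;>
    have m5 := mul (3 * a + 2 * b) t pairs.length <;>
    have m6 := mul (3 * a + 2 * b) t' pairs.length <;>
    rcases lt_trichotomy t t' with hlt | rfl | hlt <;>
    first
      | omega
      | exact absurd rfl hij
      | exact .inr ⟨rfl, h.adj (List.getElem_mem ht)⟩

theorem length_eq (h : MatchingOrder M a b σ pairs rest) : 2 * pairs.length + rest.length = n := by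
  have h1 : (pairVerts pairs ++ rest).Nodup :=
    h.listsEdges.nodup.append h.nodup_rest fun x hx hx' => h.disjoint x hx hx'
  have h2 : (pairVerts pairs ++ rest).toFinset = Finset.univ := by
    ext x
    simpa using h.cover x
  rw [← length_pairVerts, ← List.length_append, ← List.toFinset_card_of_nodup h1, h2,
    Finset.card_univ, Fintype.card_fin]

theorem makespan_eq (h : MatchingOrder M a b σ pairs rest) : makespan a b (a + b) σ =
    pairs.length * (3 * a + 2 * b) + rest.length * (2 * a + 2 * b) := by
  have mul : ∀ c t t' : ℕ, t < t' → t * c + c ≤ t' * c := by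
    intro c t t' h
    rw [← Nat.succ_mul]
    exact Nat.mul_le_mul_right c h
  apply le_antisymm
  · refine Finset.sup_le fun x _ => ?_
    rcases h.place x with ⟨t, ht, rfl⟩ | ⟨t, ht, rfl⟩ | ⟨t, ht, rfl⟩
    · rw [h.start_fst t ht]
      have := mul (3 * a + 2 * b) t _ ht
      omega
    · rw [h.start_snd t ht]
      have := mul (3 * a + 2 * b) t _ ht
      omega
    · rw [h.start_rest t ht]
      have := mul (2 * a + 2 * b) t _ ht
      omega
  · have hle : ∀ x, σ x + a + (a + b) + b ≤ makespan a b (a + b) σ := fun x =>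
      Finset.le_sup (f := fun i => σ i + a + (a + b) + b) (Finset.mem_univ x)
    rcases Nat.eq_zero_or_pos rest.length with hr | hr
    -- The length is attained by the last unmatched task or, if there is none, by the second task of
    -- the last pair. Without tasks both sides vanish.
    · rcases Nat.eq_zero_or_pos pairs.length with hp | hp
      · simp [hr, hp]
      · obtain ⟨k, hk⟩ : ∃ k, pairs.length = k + 1 := ⟨pairs.length - 1, by omega⟩
        have h1 := hle pairs[k].2
        have h2 := add_one_mul k (3 * a + 2 * b)
        rw [h.start_snd k (by omega)] at h1
        rw [hr, hk]
        omega
    · obtain ⟨k, hk⟩ : ∃ k, rest.length = k + 1 := ⟨rest.length - 1, by omega⟩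
      have h1 := hle rest[k]
      have h2 := add_one_mul k (2 * a + 2 * b)
      rw [h.start_rest k (by omega)] at h1
      rw [hk]
      omega

theorem makespan_add (h : MatchingOrder M a b σ pairs rest) :
    makespan a b (a + b) σ + pairs.length * (a + 2 * b) = n * (2 * a + 2 * b) := by
  have e : n * (2 * a + 2 * b) = (2 * pairs.length + rest.length) * (2 * a + 2 * b) := by
    rw [h.length_eq]
  rw [h.makespan_eq, e]
  ring

/-- The paths of the cover: the edges of the matching and the single vertices. -/
def path (h : MatchingOrder M a b σ pairs rest) :
    Fin pairs.length ⊕ Fin rest.length → Σ u : Fin n, Σ v : Fin n, G.Path u v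
  | .inl t => ⟨pairs[t].1, pairs[t].2, .singleton (h.adj (List.getElem_mem t.2))⟩
  | .inr t => ⟨rest[t], rest[t], .nil⟩

theorem mem_path_inl (h : MatchingOrder M a b σ pairs rest) {x : Fin n} {t : Fin pairs.length} :
    x ∈ (h.path (.inl t)).2.2.1.support ↔ x = pairs[t].1 ∨ x = pairs[t].2 := by
  simp [path, SimpleGraph.Path.singleton]

theorem mem_path_inr (h : MatchingOrder M a b σ pairs rest) {x : Fin n} {t : Fin rest.length} :
    x ∈ (h.path (.inr t)).2.2.1.support ↔ x = rest[t] := by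
  simp [path, SimpleGraph.Path.nil]

theorem path_unique (h : MatchingOrder M a b σ pairs rest) {x : Fin n}
    {c c' : Fin pairs.length ⊕ Fin rest.length} (hc : x ∈ (h.path c).2.2.1.support)
    (hc' : x ∈ (h.path c').2.2.1.support) : c = c' := by
  rcases c with t | t <;> rcases c' with t' | t' <;> simp only [mem_path_inl, mem_path_inr] at hc hc'
  · have := pairVerts_unique h.listsEdges.nodup (List.getElem_mem t.2) (List.getElem_mem t'.2) hc hc'
    rw [(nodup_of_pairVerts h.listsEdges.nodup).getElem_inj_iff] at this
    rw [Fin.ext this]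
  · refine absurd ?_ (h.disjoint x (mem_pairVerts.2 ⟨_, List.getElem_mem t.2, hc⟩))
    rw [hc']
    exact List.getElem_mem _
  · refine absurd ?_ (h.disjoint x (mem_pairVerts.2 ⟨_, List.getElem_mem t'.2, hc'⟩))
    rw [hc]
    exact List.getElem_mem _
  · have : rest[(t : ℕ)] = rest[(t' : ℕ)] := hc.symm.trans hc'
    rw [h.nodup_rest.getElem_inj_iff] at this
    rw [Fin.ext this]

theorem path_injective (h : MatchingOrder M a b σ pairs rest) : Function.Injective h.path := by
  intro c c' e
  refine h.path_unique (x := (h.path c).1) (SimpleGraph.Walk.start_mem_support _) ?_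
  rw [e]
  exact SimpleGraph.Walk.start_mem_support _

/-- The cover by the edges of the matching and the single vertices. -/
def pathCover (h : MatchingOrder M a b σ pairs rest) : PathCover G where
  paths := Finset.univ.map ⟨h.path, h.path_injective⟩
  cover x := by
    have : ∃ c, x ∈ (h.path c).2.2.1.support := by
      rcases h.place x with ⟨t, ht, rfl⟩ | ⟨t, ht, rfl⟩ | ⟨t, ht, rfl⟩
      · exact ⟨.inl ⟨t, ht⟩, h.mem_path_inl.2 (.inl rfl)⟩
      · exact ⟨.inl ⟨t, ht⟩, h.mem_path_inl.2 (.inr rfl)⟩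
      · exact ⟨.inr ⟨t, ht⟩, h.mem_path_inr.2 rfl⟩
    obtain ⟨c, hc⟩ := this
    refine ⟨h.path c, ⟨by simp, hc⟩, ?_⟩
    rintro p ⟨hp, hx⟩
    obtain ⟨c', -, rfl⟩ := Finset.mem_map.1 hp
    exact congrArg h.path (h.path_unique hx hc)

theorem mem_edges_pathCover (h : MatchingOrder M a b σ pairs rest) (e : Sym2 (Fin n)) :
    e ∈ M.edgeSet ↔ ∃ p ∈ h.pathCover.paths, e ∈ p.2.2.1.edges := by
  rw [h.listsEdges.edgeSet]
  constructor
  · rintro ⟨p, hp, rfl⟩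
    obtain ⟨t, ht, rfl⟩ := List.mem_iff_getElem.1 hp
    exact ⟨h.path (.inl ⟨t, ht⟩), by simp [pathCover], by simp [path, SimpleGraph.Path.singleton]⟩
  · rintro ⟨p, hp, he⟩
    obtain ⟨t | t, -, rfl⟩ := Finset.mem_map.1 hp
    · refine ⟨pairs[t], List.getElem_mem _, ?_⟩
      have : e = s(pairs[t].1, pairs[t].2) := by
        simpa [path, SimpleGraph.Path.singleton] using he
      exact this.symm
    · simp [path, SimpleGraph.Path.nil] at he

/-- An edge contributes `2 (a + b) + a = 3 a + 2 b` and a single vertex `(a + b) + (a + b)`, exactly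
the time that each occupies in the schedule. -/
theorem cost_pathCover (h : MatchingOrder M a b σ pairs rest) :
    h.pathCover.cost a b = makespan a b (a + b) σ := by
  rw [h.makespan_eq, PathCover.cost, pathCover, Finset.sum_map, Fintype.sum_sum_type]
  have h1 : ∀ t, (h.path (.inl t)).2.2.1.length = 1 := fun t => by
    simp [path, SimpleGraph.Path.singleton]
  have h2 : ∀ t, (h.path (.inr t)).2.2.1.length ≠ 1 := fun t => by
    simp [path, SimpleGraph.Path.nil]
  simp only [Function.Embedding.coeFn_mk, h1, h2, if_true, if_false, Finset.sum_const,
    Finset.card_univ, Fintype.card_fin, smul_eq_mul]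
  have e : n * (a + b) = (2 * pairs.length + rest.length) * (a + b) := by
    rw [h.length_eq]
  rw [e]
  ring

end MatchingOrder

/-! ### Lower bounds -/

/-- Match the first vertex of a list with the second, the third with the fourth, and so on. -/
def pairUp {V : Type*} : List V → List (V × V)
  | x :: y :: l => (x, y) :: pairUp l
  | _ => []

theorem pairVerts_pairUp_sublist {V : Type*} : ∀ l : List V, (pairVerts (pairUp l)).Sublist l
  | [] => by simp [pairUp]
  | [x] => by simp [pairUp]
  | x :: y :: l => by simpa [pairUp] using pairVerts_pairUp_sublist l

theorem length_pairUp {V : Type*} : ∀ l : List V, (pairUp l).length = l.length / 2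
  | [] => by simp [pairUp]
  | [x] => by simp [pairUp]
  | x :: y :: l => by
    simp only [pairUp, List.length_cons, length_pairUp l]
    omega

theorem adj_of_mem_pairUp {V : Type*} {G : SimpleGraph V} : ∀ l : List V, l.IsChain G.Adj →
    ∀ p ∈ pairUp l, G.Adj p.1 p.2
  | [], _ => by simp [pairUp]
  | [x], _ => by simp [pairUp]
  | x :: y :: l, h => by
    intro p hp
    rw [List.isChain_cons_cons] at h
    rcases List.mem_cons.1 hp with rfl | hp
    · exact h.1
    · exact adj_of_mem_pairUp l h.2.tail p hp

/-- The vertices on the paths of a cover. -/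
noncomputable def PathCover.verts {V : Type*} {G : SimpleGraph V} (P : PathCover G) : List V :=
  P.paths.toList.flatMap fun p => p.2.2.1.support

theorem PathCover.nodup_verts {V : Type*} {G : SimpleGraph V} (P : PathCover G) :
    P.verts.Nodup := by
  rw [verts, List.nodup_flatMap]
  refine ⟨fun p _ => p.2.2.2.support_nodup, ?_⟩
  refine (P.paths.nodup_toList).pairwise_of_forall_ne ?_
  intro p hp q hq hne x hxp hxq
  exact hne ((P.cover x).unique ⟨Finset.mem_toList.1 hp, hxp⟩ ⟨Finset.mem_toList.1 hq, hxq⟩)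

theorem PathCover.mem_verts {V : Type*} {G : SimpleGraph V} (P : PathCover G) (x : V) :
    x ∈ P.verts := by
  obtain ⟨p, ⟨h1, h2⟩, -⟩ := P.cover x
  exact List.mem_flatMap.2 ⟨p, Finset.mem_toList.2 h1, h2⟩

theorem PathCover.sum_length (P : PathCover G) :
    ∑ p ∈ P.paths, (p.2.2.1.length + 1) = n := by
  have h1 : P.verts.toFinset = Finset.univ := by
    ext x
    simpa using P.mem_verts x
  have h2 := List.toFinset_card_of_nodup P.nodup_verts
  rw [h1, Finset.card_univ, Fintype.card_fin, verts, List.length_flatMap] at h2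
  conv_rhs => rw [h2]
  rw [← Finset.sum_map_toList]
  simp

/-- Every other edge of each path, starting with the first; disjointness of the paths makes the
union a matching. -/
theorem PathCover.exists_pairs (P : PathCover G) : ∃ ps : List (Fin n × Fin n),
    (∀ p ∈ ps, G.Adj p.1 p.2) ∧ (pairVerts ps).Nodup ∧
      ps.length = ∑ p ∈ P.paths, (p.2.2.1.length + 1) / 2 := by
  refine ⟨P.paths.toList.flatMap fun p => pairUp p.2.2.1.support, ?_, ?_, ?_⟩
  · intro q hq
    obtain ⟨p, -, hp⟩ := List.mem_flatMap.1 hq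
    exact adj_of_mem_pairUp _ p.2.2.1.isChain_adj_support q hp
  · refine List.Nodup.sublist ?_ P.nodup_verts
    rw [verts]
    generalize P.paths.toList = l
    induction l with
    | nil => simp
    | cons p l ih =>
      simp only [List.flatMap_cons, pairVerts_append]
      exact (pairVerts_pairUp_sublist _).append ih
  · rw [List.length_flatMap, ← Finset.sum_map_toList]
    simp [length_pairUp]

/-- The ratio estimate for one path with `k` edges. The slack is `3 a² + 2 a b` for a single edge,
`(3 a + 2 b) (a + b)` for any other even number of vertices and `2 a (a + b)` for an odd number. It
does not grow with the path, so long paths approach the ratio. -/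
theorem path_bound (a b k : ℕ) : (2 * a + 2 * b) * ((k + 1) * (2 * a + 2 * b)) ≤
    (3 * a + 2 * b) * ((k + 1) * (a + b) + if k = 1 then a else a + b) +
      (2 * a + 2 * b) * ((k + 1) / 2 * (a + 2 * b)) := by
  split_ifs with hk
  · subst hk
    norm_num
    nlinarith
  · obtain ⟨j, hj | hj⟩ : ∃ j, k + 1 = 2 * j ∨ k + 1 = 2 * j + 1 := ⟨(k + 1) / 2, by omega⟩
    · rw [hj, Nat.mul_div_cancel_left _ (by norm_num)]
      nlinarith [Nat.zero_le ((3 * a + 2 * b) * (a + b))]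
    · rw [hj, show (2 * j + 1) / 2 = j by omega]
      nlinarith [Nat.zero_le (a * (a + b))]

theorem PathCover.bound (P : PathCover G) (a b : ℕ) : ∃ ps : List (Fin n × Fin n),
    (∀ p ∈ ps, G.Adj p.1 p.2) ∧ (pairVerts ps).Nodup ∧
      (2 * a + 2 * b) * (n * (2 * a + 2 * b)) ≤ (3 * a + 2 * b) * P.cost a b +
        (2 * a + 2 * b) * (ps.length * (a + 2 * b)) := by
  obtain ⟨ps, h1, h2, h3⟩ := P.exists_pairs
  refine ⟨ps, h1, h2, ?_⟩
  have h4 := Finset.sum_le_sum fun p (_ : p ∈ P.paths) => path_bound a b p.2.2.1.length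
  rw [Finset.sum_add_distrib, ← Finset.mul_sum, ← Finset.mul_sum, ← Finset.mul_sum,
    Finset.sum_add_distrib, ← Finset.sum_mul, ← Finset.sum_mul, ← Finset.sum_mul, P.sum_length,
    ← h3] at h4
  rwa [PathCover.cost, Fintype.card_fin]

/-- A greedy scan in order of starting times. The estimate compares the matching schedule of the
remaining tasks with the time from the first of them to `C`. An unpaired task has ratio at most 1; a
pair followed by another task meets the ratio `(3 a + 2 b) / (2 a + 2 b)` exactly, and this is the
tight case. -/
theorem schedule_bound_list {V : Type*} {G : SimpleGraph V} {τ : V → ℕ} (hab : b < a)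
    (hτ : ValidSchedule G a b (a + b) τ) {C : ℕ} : ∀ l : List V,
    l.Pairwise (fun x y => τ x ≤ τ y) → l.Nodup → (∀ x ∈ l, τ x + (2 * a + 2 * b) ≤ C) →
    ∃ ps : List (V × V), (∀ p ∈ ps, G.Adj p.1 p.2) ∧ (pairVerts ps).Sublist l ∧
      ∀ x, l.head? = some x → (2 * a + 2 * b) * (l.length * (2 * a + 2 * b)) + (3 * a + 2 * b) * τ x ≤
        (3 * a + 2 * b) * C + (2 * a + 2 * b) * (ps.length * (a + 2 * b))
  | [], _, _, _ => ⟨[], by simp⟩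
  | [x], _, _, hC => by
    refine ⟨[], by simp, by simp, ?_⟩
    have := Nat.mul_le_mul_left (3 * a + 2 * b) (hC x (by simp))
    simp only [List.head?_cons, Option.some.injEq, forall_eq', List.length_singleton,
      List.length_nil]
    nlinarith [Nat.zero_le (a * (a + b))]
  | x :: y :: l, hs, hnd, hC => by
    have hs' := List.pairwise_cons.1 hs
    have hnd' := List.nodup_cons.1 hnd
    have hxy : x ≠ y := fun e => hnd'.1 (by simp [e])
    rcases hτ.separated (by omega) hxy (hs'.1 y (by simp)) with h | ⟨h1, -, hadj⟩
    · obtain ⟨ps, k1, k2, k3⟩ := schedule_bound_list hab hτ (y :: l) hs'.2 hnd'.2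
        fun z hz => hC z (List.mem_cons_of_mem _ hz)
      refine ⟨ps, k1, k2.cons _, ?_⟩
      have k3 := k3 y rfl
      have := Nat.mul_le_mul_left (3 * a + 2 * b) h
      simp only [List.head?_cons, Option.some.injEq, forall_eq', List.length_cons] at k3 ⊢
      nlinarith [Nat.zero_le (a * (a + b))]
    · match l, hs, hnd, hC, hs', hnd' with
      | [], hs, hnd, hC, hs', hnd' =>
        refine ⟨[(x, y)], by simpa using hadj, by simp, ?_⟩
        have hCy := hC y (by simp)
        -- A final pair occupies at least `3 a + 2 b` time units, since `y` starts no earlier than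
        -- `a` after `x`.
        have := Nat.mul_le_mul_left (3 * a + 2 * b)
          (show τ x + (a + (2 * a + 2 * b)) ≤ C by omega)
        simp only [List.head?_cons, Option.some.injEq, forall_eq', List.length_cons,
          List.length_nil]
        nlinarith [Nat.zero_le (a * (a + b))]
      | z :: l, hs, hnd, hC, hs', hnd' =>
        have hs'' := List.pairwise_cons.1 hs'.2
        have hnd'' := List.nodup_cons.1 hnd'.2
        have hyz : y ≠ z := fun e => hnd''.1 (by simp [e])
        have hxz : x ≠ z := fun e => hnd'.1 (by simp [e])
        have hz1 := hτ.separated (by omega) hxz (hs'.1 z (by simp))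
        have hz2 := hτ.separated (by omega) hyz (hs''.1 z (by simp))
        -- A third task cannot overlap `x`: it starts at least `2 a` after `x`, whereas the idle
        -- time of `x` admits only starts up to `a + b < 2 a`.
        have hz : τ x + (2 * a + 2 * b) ≤ τ z := by
          rcases hz1 with h | ⟨_, h, -⟩
          · exact h
          · rcases hz2 with h' | ⟨h', -, -⟩ <;> omega
        obtain ⟨ps, k1, k2, k3⟩ := schedule_bound_list hab hτ (z :: l) hs''.2 hnd''.2
          fun u hu => hC u (List.mem_cons_of_mem _ (List.mem_cons_of_mem _ hu))
        refine ⟨(x, y) :: ps, ?_, by simpa using k2, ?_⟩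
        · intro p hp
          rcases List.mem_cons.1 hp with rfl | hp
          exacts [hadj, k1 p hp]
        have k3 := k3 z rfl
        have := Nat.mul_le_mul_left (3 * a + 2 * b) hz
        simp only [List.head?_cons, Option.some.injEq, forall_eq', List.length_cons] at k3 ⊢
        nlinarith [Nat.zero_le (a * (a + b))]

theorem ValidSchedule.bound {τ : Fin n → ℕ} (hτ : ValidSchedule G a b (a + b) τ) (hab : b < a) :
    ∃ ps : List (Fin n × Fin n), (∀ p ∈ ps, G.Adj p.1 p.2) ∧ (pairVerts ps).Nodup ∧
      (2 * a + 2 * b) * (n * (2 * a + 2 * b)) ≤ (3 * a + 2 * b) * makespan a b (a + b) τ +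
        (2 * a + 2 * b) * (ps.length * (a + 2 * b)) := by
  let l := (List.finRange n).mergeSort fun x y => τ x ≤ τ y
  have hperm : l.Perm (List.finRange n) := List.mergeSort_perm _ _
  have hnd : l.Nodup := hperm.nodup_iff.2 (List.nodup_finRange n)
  have hs : l.Pairwise (fun x y => τ x ≤ τ y) := by
    have := List.pairwise_mergeSort (le := fun x y => decide (τ x ≤ τ y))
      (by simpa using fun _ _ _ => le_trans) (by simpa using fun x y => le_total _ _)
      (List.finRange n)
    simpa using this
  have hlen : l.length = n := by rw [hperm.length_eq, List.length_finRange]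
  obtain ⟨ps, h1, h2, h3⟩ := schedule_bound_list hab hτ (C := makespan a b (a + b) τ) l hs hnd
    fun x _ => by
      have : τ x + a + (a + b) + b ≤ makespan a b (a + b) τ :=
        Finset.le_sup (f := fun i => τ i + a + (a + b) + b) (Finset.mem_univ x)
      omega
  refine ⟨ps, h1, h2.nodup hnd, ?_⟩
  rw [hlen] at h3
  rcases hl : l with _ | ⟨x, l'⟩
  · have : n = 0 := by rw [← hlen, hl]; rfl
    simp [this]
  -- The term with the earliest starting time is nonnegative and can be dropped.
  · have := h3 x (by rw [hl]; rfl)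
    omega

theorem le_ratio_mul {a b x y : ℕ} (ha : 0 < a)
    (h : (2 * a + 2 * b) * x ≤ (3 * a + 2 * b) * y) :
    (x : ℝ) ≤ (3 * (a : ℝ) + 2 * b) / (2 * a + 2 * b) * y := by
  have hpos : (0 : ℝ) < 2 * a + 2 * b := by positivity
  rw [div_mul_eq_mul_div, le_div_iff₀ hpos, mul_comm]
  exact_mod_cast h

end Schedules

/-- After cross-multiplication the lower bound amounts to `0 < 2 (a - b)` and the upper bounds to `0
≤ 2 b` and `0 < 2 b`. -/
theorem ratio_bounds {a b : ℕ} (hab : b < a) :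
    5 / 4 < (3 * (a : ℝ) + 2 * b) / (2 * a + 2 * b) ∧
    (3 * (a : ℝ) + 2 * b) / (2 * a + 2 * b) ≤ 3 / 2 ∧
    (0 < b → (3 * (a : ℝ) + 2 * b) / (2 * a + 2 * b) < 3 / 2) := by
  have h1 : (b : ℝ) < a := by exact_mod_cast hab
  have h2 : (0 : ℝ) ≤ b := by positivity
  have hpos : (0 : ℝ) < 2 * a + 2 * b := by linarith
  refine ⟨?_, ?_, fun hb => ?_⟩
  · rw [div_lt_div_iff₀ (by norm_num) hpos]
    linarith
  · rw [div_le_div_iff₀ hpos (by norm_num)]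
    linarith
  · have hb : (0 : ℝ) < b := by exact_mod_cast hb
    rw [div_lt_div_iff₀ hpos (by norm_num)]
    linarith

theorem mainTheorem2 :
    -- the schedule from any maximum matching: validity, path cover, performance ratio
    (∀ (n a b : ℕ), b < a → ∀ (G : SimpleGraph (Fin n)) (M : G.Subgraph), IsMaximumMatching M →
      ∀ σ : Fin n → ℕ, IsMatchingSchedule M a b σ →
        ValidSchedule G a b (a + b) σ ∧
        (∃ P : PathCover G,
          (∀ e : Sym2 (Fin n), e ∈ M.edgeSet ↔ ∃ p ∈ P.paths, e ∈ p.2.2.1.edges) ∧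
          P.cost a b = makespan a b (a + b) σ) ∧
        (∀ P : PathCover G,
          (makespan a b (a + b) σ : ℝ) ≤
            (3 * (a : ℝ) + 2 * b) / (2 * a + 2 * b) * (P.cost a b : ℝ)) ∧
        (∀ τ : Fin n → ℕ, ValidSchedule G a b (a + b) τ →
          (makespan a b (a + b) σ : ℝ) ≤
            (3 * (a : ℝ) + 2 * b) / (2 * a + 2 * b) * (makespan a b (a + b) τ : ℝ))) ∧
    -- one program computes such a schedule in polynomial time on all instances
    (∃ (prog : RAM.Prog) (q : Polynomial ℕ),
      ∀ (n a b : ℕ), b < a → ∀ G : SimpleGraph (Fin n),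
        ∃ (t : ℕ) (s : RAM.State),
          RAM.Runs prog (inputState G a b) t s ∧
          t ≤ q.eval (inputSize n a b) ∧
          ∃ M : G.Subgraph, IsMaximumMatching M ∧
            IsMatchingSchedule M a b (outputSchedule n s)) ∧
    -- the range of the ratio
    (∀ (a b : ℕ), b < a →
      5 / 4 < (3 * (a : ℝ) + 2 * b) / (2 * a + 2 * b) ∧
      (3 * (a : ℝ) + 2 * b) / (2 * a + 2 * b) ≤ 3 / 2 ∧
      (0 < b → (3 * (a : ℝ) + 2 * b) / (2 * a + 2 * b) < 3 / 2)) := by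
  refine ⟨?_, ?_, fun a b hab => ratio_bounds hab⟩
  · intro n a b hab G M hM σ hσ
    have ha : 0 < a := by omega
    obtain ⟨pairs, rest, h⟩ := hσ.exists_order hM.1
    -- Both comparisons reduce to this: the competitor of value `X` supplies a matching `ps`, and
    -- replacing `ps` by the maximum matching only enlarges the saving. By `makespan_add` that
    -- saving then cancels against the sequential length.
    have key : ∀ X, (∃ ps : List (Fin n × Fin n), (∀ p ∈ ps, G.Adj p.1 p.2) ∧
        (pairVerts ps).Nodup ∧ (2 * a + 2 * b) * (n * (2 * a + 2 * b)) ≤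
          (3 * a + 2 * b) * X + (2 * a + 2 * b) * (ps.length * (a + 2 * b))) →
        (makespan a b (a + b) σ : ℝ) ≤ (3 * (a : ℝ) + 2 * b) / (2 * a + 2 * b) * (X : ℝ) := by
      rintro X ⟨ps, h1, h2, h3⟩
      refine le_ratio_mul ha ?_
      have h4 := Nat.mul_le_mul_left (2 * a + 2 * b) (Nat.mul_le_mul_right (a + 2 * b)
        (length_le_of_isMaximumMatching hM h.listsEdges h1 h2))
      rw [← h.makespan_add, Nat.mul_add] at h3
      omega
    exact ⟨validSchedule_of_separated hab (h.separated ha),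
      ⟨h.pathCover, h.mem_edges_pathCover, h.cost_pathCover⟩,
      fun P => key _ (P.bound a b), fun τ hτ => key _ (hτ.bound hab)⟩
  · obtain ⟨prog, q, h⟩ := RAM.exists_prog
    exact ⟨prog, q, fun n a b _ G => h n a b G⟩
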